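/- **Setting.** Let $D$ be a finite or countable set. For every $n\in\mathbb Z_+$ let $\mathbf T_n=(\tau_n(z,z'))_{z,z'\in D}$ be the generator (stable, conservative, non-explosive) of an irreducible continuous-time Markov chain on $D$, and let $v:D\to[0,\infty)$, $v\not\equiv 0$, satisfy $v(z)\sum_{z'}\tau_n(z,z')=\sum_{z'}v(z')\tau_n(z',z)$ for all $n\ge 0$, $z\in D$. Let $\lambda,\mu:D\to(0,\infty)$ and $\rho(z)=\lambda(z)/\mu(z)$. The $M/M/1$ queue in the interactive jump environment is the Markov process $(N,Z)$ on $\mathbb Z_+\times D$ that jumps from $(n,z)$ to $(n+1,z)$ at rate $\lambda(z)$, to $(n-1,z)$ at rate $\mu(z)$ (if $n\ge1$), and to $(n,z')$, $z'\ne z$, at rate $\rho^{-n}(z)\tau_n(z,z')$, with no other jumps; $P^t((n,z),\cdot)$ is its (minimal) transition function. Assume $\Xi:=\sum_{z\in D}\frac{v(z)}{1-\rho(z)}<\infty$ and put $\pi(n,z):=\Xi^{-1}\rho^n(z)v(z)$. **Theorem.** Suppose that 1. there are constants $\overline\lambda,\overline\mu>0$ with $\lambda(z)\le\overline\lambda<\overline\mu\le\mu(z)$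 for all $z\in D$; 2. there are constants $\alpha>1$ and $\gamma>0$ such that for all $z_1,z_2\in D$ one can define on one probability space two Markov chains $Z_1,Z_2$ with generator $\mathbf T_0$, $Z_1(0)=z_1$, $Z_2(0)=z_2$, and a random time $\tau_{z_1,z_2}\in[0,\infty]$ with $Z_1(t)=Z_2(t)$ for all $t\ge\tau_{z_1,z_2}$ almost surely and $\mathbb P(\tau_{z_1,z_2}\ge t)\le\alpha e^{-\gamma t}$ for all $t\ge0$. Let $m(c)=-\overline\lambda c-\overline\mu c^{-1}+(\overline\lambda+\overline\mu)$, $c^*=(\overline\lambda/\overline\mu)^{-1/2}$ and, for $0\le a<\beta+\gamma$, $$\theta(\alpha,\beta,\gamma,a)=\frac{a\gamma}{(a-\beta)(\beta+\gamma-a)}\,\alpha^{(a-\beta)/\gamma}+\frac{\beta}{\beta-a},$$ extended by continuity to $a=\beta$, that is, $\theta(\alpha,\beta,\gamma,\beta)=1+\frac{\beta}{\gamma}(1+\ln\alpha)$. Call $(\varepsilon,c)$ admissible if $\varepsilon\in(0,1)$, $c\in(1,c^*)$, $m(c)<\overline\lambda+\gamma$ and $$c\,\theta(\alpha,\overline\lambda,\gamma,m(c))<\Bigl(1-\alpha^{-\overline\lambda/\gamma}\frac{\gamma}{\overline\lambda+\gamma}\Bigr)^{-\varepsilon/(1-\varepsilon)}.$$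 Then for every $\varepsilon\in(0,1)$ there is a $c$ such that $(\varepsilon,c)$ is admissible, and for every admissible $(\varepsilon,c)$ there is a constant $C>0$ such that for all $(n_0,z_0)\in\mathbb Z_+\times D$ and all $t\ge0$ $$\|P^t((n_0,z_0),\cdot)-\pi\|_{TV}\le C\,(1+c^{n_0})\,e^{-(1-\varepsilon)m(c)t},$$ where $\|\mu_1-\mu_2\|_{TV}=\sup_A|\mu_1(A)-\mu_2(A)|$. -/

import Mathlib

open MeasureTheory Filter Topology Set
open scoped ENNReal NNReal

universe u w

noncomputable section

namespace InteractiveQueue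

/-! ### Continuous-time Markov chains on a countable state space -/

section Chains

variable {S : Type*}

/-- Stable conservative rate matrices: nonnegative off-diagonal entries, summable rows, row sums
equal to zero (so `-Q x x` is the total jump rate out of `x`). -/
structure IsRateMatrix (Q : S → S → ℝ) : Prop where
  offDiag_nonneg : ∀ x y, x ≠ y → 0 ≤ Q x y
  row_sum : ∀ x, HasSum (Q x) 0

open Classical in
/-- The jump rate from `x` to `y`, set to `0` on the diagonal. -/
def jumpRate (Q : S → S → ℝ) (x y : S) : ℝ≥0∞ :=
  if x = y then 0 else ENNReal.ofReal (Q x y)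

open Classical in
/-- The probability that the minimal chain with rate matrix `Q`, started at `x`, is at `y` at
time `t` after fewer than `k` jumps, by conditioning on the first jump. -/
def transBefore (Q : S → S → ℝ) : ℕ → ℝ → S → S → ℝ≥0∞
  | 0, _, _, _ => 0
  | k + 1, t, x, y =>
      (if x = y then ENNReal.ofReal (Real.exp (Q x x * t)) else 0) +
        ∫⁻ s in Icc (0 : ℝ) t, ENNReal.ofReal (Real.exp (Q x x * s)) *
          ∑' w, jumpRate Q x w * transBefore Q k (t - s) w y

/-- The transition probabilities `P^t(x, y)`, `t ≥ 0`, of the Markov chain with rate matrix `Q`: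
the minimal (Feller) transition function. -/
def trans (Q : S → S → ℝ) (t : ℝ) (x y : S) : ℝ≥0∞ :=
  ⨆ k, transBefore Q k t x y

/-- The transition kernel `P^t(x, ·)` as a measure. -/
def transMeasure [MeasurableSpace S] (Q : S → S → ℝ) (t : ℝ) (x : S) : Measure S :=
  Measure.sum fun y => trans Q t x y • Measure.dirac y

/-- `Q` is the generator of a continuous-time Markov chain living on `S` for all times:
a stable conservative rate matrix whose chain does not explode. -/
structure IsChainGenerator (Q : S → S → ℝ) : Prop extends IsRateMatrix Q where
  nonexplosive : ∀ t : ℝ, 0 ≤ t → ∀ x, ∑' y, trans Q t x y = 1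

/-- Every state can be reached from every other one by jumps of positive rate. -/
def IsIrreducible (Q : S → S → ℝ) : Prop :=
  ∀ x y, Relation.ReflTransGen (fun a b => a ≠ b ∧ 0 < Q a b) x y

open Classical in
/-- `Z` is a right-continuous Markov chain with generator `Q` started at `x₀`, defined on the
probability space `(Ω, Pr)`; the law is given through the finite-dimensional distributions. -/
structure IsMarkovChainFrom {Ω : Type*} [MeasurableSpace Ω] [MeasurableSpace S]
    (Q : S → S → ℝ) (x₀ : S) (Pr : Measure Ω) (Z : ℝ≥0 → Ω → S) : Prop where
  measurable : ∀ t, Measurable (Z t)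
  right_continuous : ∀ᵐ ω ∂Pr, ∀ t : ℝ≥0, ∀ᶠ s in 𝓝[>] t, Z s ω = Z t ω
  fdd : ∀ (m : ℕ) (t : ℕ → ℝ≥0) (x : ℕ → S), Monotone t → t 0 = 0 →
    Pr {ω | ∀ i ≤ m, Z (t i) ω = x i} =
      (if x 0 = x₀ then 1 else 0) *
        ∏ i ∈ Finset.range m, trans Q ((t (i + 1) : ℝ) - t i) (x i) (x (i + 1))

/-- For any two initial states, the chains with generator `Q` can be coupled in a random time `τ`
(they coincide from time `τ` on) with the uniform tail bound `ℙ(τ ≥ t) ≤ α e^{-γ t}`. -/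
def HasExpCoupling {S : Type u} [MeasurableSpace S] (Q : S → S → ℝ) (α γ : ℝ) : Prop :=
  ∀ z₁ z₂ : S, ∃ (Ω : Type w) (_ : MeasurableSpace Ω) (Pr : Measure Ω)
    (Z₁ Z₂ : ℝ≥0 → Ω → S) (τ : Ω → ℝ≥0∞),
    IsProbabilityMeasure Pr ∧
    IsMarkovChainFrom Q z₁ Pr Z₁ ∧ IsMarkovChainFrom Q z₂ Pr Z₂ ∧
    Measurable τ ∧
    (∀ᵐ ω ∂Pr, ∀ t : ℝ≥0, τ ω ≤ t → Z₁ t ω = Z₂ t ω) ∧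
    ∀ t : ℝ≥0, Pr {ω | (t : ℝ≥0∞) ≤ τ ω} ≤ ENNReal.ofReal (α * Real.exp (-γ * t))

/-- Total variation distance `sup_A |μ(A) - ν(A)|` of two finite measures. -/
def tvDist [MeasurableSpace S] (μ ν : Measure S) : ℝ :=
  ⨆ A : {A : Set S // MeasurableSet A}, |μ.real A - ν.real A|

end Chains

/-! ### The `M/M/1` queue in an interactive jump environment -/

section Queue

variable {D : Type*}

/-- The generator of the `M/M/1` queue with arrival rate `l` and service rate `m`. -/
def mm1 (l m : ℝ) (n n' : ℕ) : ℝ :=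
  if n' = n + 1 then l
  else if n = n' + 1 then m
  else if n = n' then -(l + if n = 0 then 0 else m)
  else 0

open Classical in
/-- The generator of `(N, Z)`: in state `(n, z)` the queue moves as an `M/M/1` queue with rates
`lam z`, `mu z`, and the environment moves with generator `ρ(z)^{-n} T n`, `ρ = lam / mu`;
there are no simultaneous jumps. -/
def queueGen (lam mu : D → ℝ) (T : ℕ → D → D → ℝ) (x y : ℕ × D) : ℝ :=
  (if x.2 = y.2 then mm1 (lam x.2) (mu x.2) x.1 y.1 else 0) +
    (if x.1 = y.1 then ((lam x.2 / mu x.2) ^ x.1)⁻¹ * T x.1 x.2 y.2 else 0)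

/-- `v` is a nonzero measure on `D` that is invariant for every generator `T n`. -/
structure IsCommonInvariant (T : ℕ → D → D → ℝ) (v : D → ℝ) : Prop where
  nonneg : ∀ z, 0 ≤ v z
  ne_zero : v ≠ 0
  balance : ∀ n z, HasSum (fun z' => v z' * T n z' z) (v z * ∑' z', T n z z')

/-- The normalization constant `Ξ = ∑_z v(z) / (1 - ρ(z))`. -/
def normConst (lam mu v : D → ℝ) : ℝ :=
  ∑' z, v z / (1 - lam z / mu z)

/-- The probability measure `π(n, z) = Ξ⁻¹ ρ(z)^n v(z)`. -/
def stationary [MeasurableSpace D] (lam mu v : D → ℝ) : Measure (ℕ × D) :=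
  Measure.sum fun x : ℕ × D =>
    ENNReal.ofReal ((lam x.2 / mu x.2) ^ x.1 * v x.2 / normConst lam mu v) • Measure.dirac x

end Queue

/-! ### Admissible parameters -/

/-- `m(c) = -λ̄ c - μ̄ c⁻¹ + (λ̄ + μ̄)`. -/
def mFun (lamBar muBar c : ℝ) : ℝ :=
  -lamBar * c - muBar * c⁻¹ + (lamBar + muBar)

/-- `c* = (λ̄ / μ̄)^{-1/2}`. -/
def cStar (lamBar muBar : ℝ) : ℝ :=
  (lamBar / muBar) ^ (-(1 / 2) : ℝ)

/-- The function `θ(α, β, γ, a)` for `0 ≤ a < β + γ`; at the removable singularity `a = β` it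
takes its limit value. -/
def theta (α β γ a : ℝ) : ℝ :=
  if a = β then 1 + β / γ * (1 + Real.log α)
  else a * γ / ((a - β) * (β + γ - a)) * α ^ ((a - β) / γ) + β / (β - a)

/-- The admissible pairs `(ε, c)`. The requirement `m(c) < λ̄ + γ` says that `m(c)` lies in the
range `[0, β + γ)`, `β = λ̄`, of the last argument of `θ`. -/
structure Admissible (lamBar muBar α γ ε c : ℝ) : Prop where
  eps_mem : ε ∈ Ioo (0 : ℝ) 1
  c_mem : c ∈ Ioo 1 (cStar lamBar muBar)
  m_lt : mFun lamBar muBar c < lamBar + γ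
  bound : c * theta α lamBar γ (mFun lamBar muBar c) <
    (1 - α ^ (-lamBar / γ) * (γ / (lamBar + γ))) ^ (-ε / (1 - ε))

end InteractiveQueue

end

/-!
Two queues started from different states are compared through the functions `U_t = P^t f`,
`0 ≤ f ≤ 1`. The oscillation of `U_t` over the states at levels up to `n` is shown to be at most
`K b^n e^{-at}`, where `b = c^{1-ε}` and `a = (1-ε) m(c)` (`QueueAssumptions.osc_le`). Integrating
this bound against the stationary distribution `π`, under which `c^N` is integrable, yields the
theorem (`QueueAssumptions.tvDist_le`).

The oscillation bound is a supersolution argument. The queue is uniformized: it is a pure-death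
chain in the environment, interrupted at constant total rate by arrivals, fictitious arrivals, and
services (`isSplitting_levelGen`), and `U_t` solves the renewal equation at the first interruption
(`IsSplitting.semi_eq_renewal`).

* At levels `n ≥ 1` the interruptions have rate `lamBar + muBar`. Those of the two queues are
  simultaneous, so that the larger level is dominated by an `M/M/1` queue with rates `lamBar`,
  `muBar`, for which `b^n e^{-at}` is a supersolution since `m(b) ≥ (1-ε) m(c)` by concavity
  (`mFun_rpow_ge`, `QueueAssumptions.osc_step_succ`).
* At level `0` the interruptions are the possible arrivals, of rate `lamBar`. Until then the two
  environments evolve with generator `T 0`, and the coupling inequality makes the contribution of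
  the interruption at time `s` smaller by the factor `min(1, α e^{-γ s})`
  (`QueueAssumptions.osc_step_zero`). A supersolution is obtained if the discounted probability of
  a failed coupling, including the factor `b` for starting again from level one, is smaller than
  one. By Hölder's inequality this is the admissibility condition
  (`Admissible.exists_contraction`).

The renewal equation and the stationarity of `π` hold for the minimal transition function only
because the queue does not explode. In the resolvent domain, explosion means a nonzero bounded
`φ ≥ 0` with `φ ≤ Q φ` (`tsum_trans_eq_one_of_forall`). For the death chain this gives, level by
level, `ρ^n φ ≤ T_n φ`; integrating against the summable invariant measure `v` of the
non-explosive chain `T_n` forces `φ = 0` (`eq_zero_of_mul_le_generator`). Interruptions of bounded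
rate do not change this (`IsSplitting.semi_one`).

Transition functions are treated as kernels with values in functions of time, vanishing at negative
times, with the associative product `kerConv`; all quantities are in `ℝ≥0∞`.
-/

namespace InteractiveQueue

/-! ### Time-dependent kernels and their convolution -/

section Convolution

variable {S : Type*}

theorem tsum_iSup_of_monotone {ι : Type*} (f : ℕ → ι → ℝ≥0∞) (hf : ∀ i, Monotone fun k => f k i) :
    ∑' i, ⨆ k, f k i = ⨆ k, ∑' i, f k i := by
  simp_rw [ENNReal.tsum_eq_iSup_sum]
  rw [iSup_comm]
  exact iSup_congr fun s => ENNReal.finsetSum_iSup_of_monotone fun i => hf i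

/-- Families of nonnegative functions of time indexed by pairs of states, thought of as
time-dependent matrices; all those of interest vanish at negative times. -/
abbrev TimeKernel (S : Type*) := S → S → ℝ → ℝ≥0∞

/-- The product `K J L`: matrix multiplication in space, convolution in time. -/
noncomputable def kerConv (K : TimeKernel S) (J : S → S → ℝ≥0∞) (L : TimeKernel S) :
    TimeKernel S :=
  fun x y t => ∑' w, ∑' w', J w w' * (K x w ⋆ₗ L w' y) t

theorem lconvolution_mono {f f' g g' : ℝ → ℝ≥0∞} (hf : f ≤ f') (hg : g ≤ g') :
    f ⋆ₗ g ≤ f' ⋆ₗ g' := fun _ => lintegral_mono fun s => mul_le_mul' (hf s) (hg _)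

theorem lconvolution_tsum {ι : Type*} [Countable ι] {f : ℝ → ℝ≥0∞} {g : ι → ℝ → ℝ≥0∞}
    (hf : Measurable f) (hg : ∀ i, Measurable (g i)) (t : ℝ) :
    (f ⋆ₗ fun s => ∑' i, g i s) t = ∑' i, (f ⋆ₗ g i) t := by
  simp only [lconvolution_def, ← ENNReal.tsum_mul_left]
  exact lintegral_tsum fun i => by have := hg i; fun_prop

theorem tsum_lconvolution {ι : Type*} [Countable ι] {f : ι → ℝ → ℝ≥0∞} {g : ℝ → ℝ≥0∞}
    (hf : ∀ i, Measurable (f i)) (hg : Measurable g) (t : ℝ) :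
    ((fun s => ∑' i, f i s) ⋆ₗ g) t = ∑' i, (f i ⋆ₗ g) t := by
  simp only [lconvolution_def, ← ENNReal.tsum_mul_right]
  exact lintegral_tsum fun i => by have := hf i; fun_prop

theorem const_mul_lconvolution {f g : ℝ → ℝ≥0∞} (hf : Measurable f) (hg : Measurable g)
    (c : ℝ≥0∞) (t : ℝ) : ((fun s => c * f s) ⋆ₗ g) t = c * (f ⋆ₗ g) t := by
  simp only [lconvolution_def, mul_assoc]
  exact lintegral_const_mul _ (by fun_prop)

theorem lconvolution_const_mul {f g : ℝ → ℝ≥0∞} (hf : Measurable f) (hg : Measurable g)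
    (c : ℝ≥0∞) (t : ℝ) : (f ⋆ₗ fun s => c * g s) t = c * (f ⋆ₗ g) t := by
  simp only [lconvolution_def, mul_left_comm _ c]
  exact lintegral_const_mul _ (by fun_prop)

variable [Countable S]

theorem measurable_kerConv {K L : TimeKernel S} {J : S → S → ℝ≥0∞}
    (hK : ∀ x y, Measurable (K x y)) (hL : ∀ x y, Measurable (L x y)) (x y : S) :
    Measurable (kerConv K J L x y) :=
  Measurable.tsum fun _ => Measurable.tsum fun _ =>
    (measurable_lconvolution _ (hK _ _) (hL _ _)).const_mul _

theorem kerConv_assoc {K L M : TimeKernel S} (I J : S → S → ℝ≥0∞)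
    (hK : ∀ x y, Measurable (K x y)) (hL : ∀ x y, Measurable (L x y))
    (hM : ∀ x y, Measurable (M x y)) :
    kerConv K I (kerConv L J M) = kerConv (kerConv K I L) J M := by
  have hc : ∀ {K L : TimeKernel S}, (∀ x y, Measurable (K x y)) → (∀ x y, Measurable (L x y)) →
      ∀ x w w' y, Measurable (K x w ⋆ₗ L w' y) := fun hK hL x w w' y =>
    measurable_lconvolution _ (hK _ _) (hL _ _)
  funext x y t
  have h1 : ∀ w w', (K x w ⋆ₗ kerConv L J M w' y) t
      = ∑' a, ∑' b, J a b * (K x w ⋆ₗ L w' a ⋆ₗ M b y) t := by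
    intro w w'
    unfold kerConv
    rw [lconvolution_tsum (hK _ _) fun a => Measurable.tsum fun b =>
      (hc hL hM _ _ _ _).const_mul _]
    refine tsum_congr fun a => ?_
    rw [lconvolution_tsum (hK _ _) fun b => (hc hL hM _ _ _ _).const_mul _]
    exact tsum_congr fun b => lconvolution_const_mul (hK _ _) (hc hL hM _ _ _ _) _ _
  have h2 : ∀ a b, (kerConv K I L x a ⋆ₗ M b y) t
      = ∑' w, ∑' w', I w w' * (K x w ⋆ₗ L w' a ⋆ₗ M b y) t := by
    intro a b
    unfold kerConv
    rw [tsum_lconvolution (fun a => Measurable.tsum fun b =>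
      (hc hK hL _ _ _ _).const_mul _) (hM _ _)]
    refine tsum_congr fun w => ?_
    rw [tsum_lconvolution (fun b => (hc hK hL _ _ _ _).const_mul _) (hM _ _)]
    refine tsum_congr fun w' => ?_
    rw [const_mul_lconvolution (hc hK hL _ _ _ _) (hM _ _),
      lconvolution_assoc (hK _ _) (hL _ _) (hM _ _)]
  rw [kerConv, kerConv]
  simp_rw [h1, h2, ← ENNReal.tsum_mul_left]
  calc ∑' w, ∑' w', ∑' a, ∑' b, I w w' * (J a b * (K x w ⋆ₗ L w' a ⋆ₗ M b y) t)
      = ∑' w, ∑' a, ∑' b, ∑' w', I w w' * (J a b * (K x w ⋆ₗ L w' a ⋆ₗ M b y) t) := by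
        refine tsum_congr fun w => ?_
        rw [ENNReal.tsum_comm]
        exact tsum_congr fun a => ENNReal.tsum_comm
    _ = ∑' a, ∑' b, ∑' w, ∑' w', I w w' * (J a b * (K x w ⋆ₗ L w' a ⋆ₗ M b y) t) := by
        rw [ENNReal.tsum_comm]
        exact tsum_congr fun a => ENNReal.tsum_comm
    _ = _ := by simp_rw [mul_left_comm]

omit [Countable S] in
theorem kerConv_mono {K K' L L' : TimeKernel S} {J J' : S → S → ℝ≥0∞} (hK : K ≤ K') (hJ : J ≤ J')
    (hL : L ≤ L') : kerConv K J L ≤ kerConv K' J' L' := fun _ _ t =>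
  ENNReal.tsum_le_tsum fun _ => ENNReal.tsum_le_tsum fun _ =>
    mul_le_mul' (hJ _ _) (lconvolution_mono (hK _ _) (hL _ _) t)

omit [Countable S] in
theorem kerConv_add_right {K L L' : TimeKernel S} (J : S → S → ℝ≥0∞)
    (hK : ∀ x y, Measurable (K x y)) (hL : ∀ x y, Measurable (L x y)) :
    kerConv K J (L + L') = kerConv K J L + kerConv K J L' := by
  funext x y t
  simp only [kerConv, Pi.add_apply, ← ENNReal.tsum_add]
  refine tsum_congr fun w => tsum_congr fun w' => ?_
  rw [← mul_add]
  congr 1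
  simp only [lconvolution_def, Pi.add_apply, mul_add]
  exact lintegral_add_left (by have := hK x w; have := hL w' y; fun_prop) _

omit [Countable S] in
theorem kerConv_add_left {K K' L : TimeKernel S} (J : S → S → ℝ≥0∞)
    (hK : ∀ x y, Measurable (K x y)) (hL : ∀ x y, Measurable (L x y)) :
    kerConv (K + K') J L = kerConv K J L + kerConv K' J L := by
  funext x y t
  simp only [kerConv, Pi.add_apply, ← ENNReal.tsum_add]
  refine tsum_congr fun w => tsum_congr fun w' => ?_
  rw [← mul_add]
  congr 1
  simp only [lconvolution_def, Pi.add_apply, add_mul]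
  exact lintegral_add_left (by have := hK x w; have := hL w' y; fun_prop) _

omit [Countable S] in
theorem kerConv_add_mid (K L : TimeKernel S) (J J' : S → S → ℝ≥0∞) :
    kerConv K (J + J') L = kerConv K J L + kerConv K J' L := by
  funext x y t
  simp only [kerConv, Pi.add_apply, ← ENNReal.tsum_add, add_mul]

omit [Countable S] in
@[simp]
theorem kerConv_zero_right (K : TimeKernel S) (J : S → S → ℝ≥0∞) : kerConv K J 0 = 0 := by
  funext x y t
  simp [kerConv]

omit [Countable S] in
@[simp]
theorem kerConv_zero_left (K : TimeKernel S) (J : S → S → ℝ≥0∞) : kerConv 0 J K = 0 := by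
  funext x y t
  simp [kerConv]

omit [Countable S] in
/-- Monotone convergence in the left factor of a kernel product. -/
theorem kerConv_iSup_left {K : ℕ → TimeKernel S} {L : TimeKernel S} (J : S → S → ℝ≥0∞)
    (hmono : Monotone K) (hK : ∀ k x y, Measurable (K k x y)) (hL : ∀ x y, Measurable (L x y)) :
    kerConv (fun x y t => ⨆ k, K k x y t) J L = fun x y t => ⨆ k, kerConv (K k) J L x y t := by
  funext x y t
  have h : ∀ w w', ((fun t => ⨆ k, K k x w t) ⋆ₗ L w' y) t = ⨆ k, (K k x w ⋆ₗ L w' y) t := by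
    intro w w'
    simp only [lconvolution_def, ENNReal.iSup_mul]
    refine lintegral_iSup (fun k => by have := hK k x w; have := hL w' y; fun_prop) ?_
    intro i j hij s
    exact mul_le_mul' (hmono hij x w s) le_rfl
  have hm : ∀ w w', Monotone fun k => J w w' * (K k x w ⋆ₗ L w' y) t := fun w w' i j hij =>
    mul_le_mul' le_rfl (lconvolution_mono (hmono hij x w) le_rfl t)
  simp only [kerConv, h, ENNReal.mul_iSup]
  simp_rw [tsum_iSup_of_monotone _ (hm _)]
  exact tsum_iSup_of_monotone _ fun w i j hij => ENNReal.tsum_le_tsum fun w' => hm w w' hij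

omit [Countable S] in
/-- Monotone convergence in the right factor of a kernel product. -/
theorem kerConv_iSup_right {K : ℕ → TimeKernel S} {L : TimeKernel S} (J : S → S → ℝ≥0∞)
    (hmono : Monotone K) (hK : ∀ k x y, Measurable (K k x y)) (hL : ∀ x y, Measurable (L x y)) :
    kerConv L J (fun x y t => ⨆ k, K k x y t) = fun x y t => ⨆ k, kerConv L J (K k) x y t := by
  funext x y t
  have h : ∀ w w', (L x w ⋆ₗ fun t => ⨆ k, K k w' y t) t = ⨆ k, (L x w ⋆ₗ K k w' y) t := by
    intro w w'
    simp only [lconvolution_def, ENNReal.mul_iSup]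
    refine lintegral_iSup (fun k => by have := hK k w' y; have := hL x w; fun_prop) ?_
    intro i j hij s
    exact mul_le_mul' le_rfl (hmono hij w' y _)
  have hm : ∀ w w', Monotone fun k => J w w' * (L x w ⋆ₗ K k w' y) t := fun w w' i j hij =>
    mul_le_mul' le_rfl (lconvolution_mono le_rfl (hmono hij w' y) t)
  simp only [kerConv, h, ENNReal.mul_iSup]
  simp_rw [tsum_iSup_of_monotone _ (hm _)]
  exact tsum_iSup_of_monotone _ fun w i j hij => ENNReal.tsum_le_tsum fun w' => hm w w' hij

omit [Countable S] in
theorem lconvolution_eq_setLIntegral {f g : ℝ → ℝ≥0∞} (hf : ∀ s < 0, f s = 0)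
    (hg : ∀ s < 0, g s = 0) (t : ℝ) :
    (f ⋆ₗ g) t = ∫⁻ s in Icc 0 t, f s * g (t - s) := by
  rw [lconvolution_def, ← lintegral_indicator measurableSet_Icc]
  refine lintegral_congr fun s => ?_
  by_cases hs : s ∈ Icc 0 t
  · rw [indicator_of_mem hs, neg_add_eq_sub]
  · rw [indicator_of_notMem hs, neg_add_eq_sub]
    by_cases h0 : s < 0
    · simp [hf s h0]
    · rw [hg _ (by by_contra h; exact hs ⟨by linarith, by linarith⟩), mul_zero]

end Convolution

/-! ### Exponential holding times -/

section Exponential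

/-- The exponential `t ↦ e^{at}` on `[0, ∞)`, extended by zero to negative times. -/
noncomputable def expPos (a : ℝ) : ℝ → ℝ≥0∞ :=
  (Ici 0).indicator fun t => ENNReal.ofReal (Real.exp (a * t))

theorem expPos_of_nonneg (a : ℝ) {t : ℝ} (ht : 0 ≤ t) :
    expPos a t = ENNReal.ofReal (Real.exp (a * t)) := indicator_of_mem (by exact ht) _

theorem expPos_of_neg (a : ℝ) {t : ℝ} (ht : t < 0) : expPos a t = 0 :=
  indicator_of_notMem (by simpa using ht) _

@[fun_prop]
theorem measurable_expPos (a : ℝ) : Measurable (expPos a) :=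
  Measurable.indicator (by fun_prop) measurableSet_Ici

theorem setLIntegral_ofReal_Icc {f F : ℝ → ℝ} {t : ℝ} (ht : 0 ≤ t) (hF : ∀ s, HasDerivAt F (f s) s)
    (hf : Continuous f) (h0 : ∀ s ∈ Icc 0 t, 0 ≤ f s) :
    ∫⁻ s in Icc 0 t, ENNReal.ofReal (f s) = ENNReal.ofReal (F t - F 0) := by
  rw [← ofReal_integral_eq_lintegral_ofReal (hf.integrableOn_Icc)
    ((ae_restrict_iff' measurableSet_Icc).2 (ae_of_all _ h0)), integral_Icc_eq_integral_Ioc,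
    ← intervalIntegral.integral_of_le ht,
    intervalIntegral.integral_eq_sub_of_hasDerivAt (fun s _ => hF s) (hf.intervalIntegrable _ _)]

/-- A rate times the integral of the survival function of an exponential time. -/
theorem ofReal_mul_setLIntegral_exp {r t : ℝ} (hr : 0 ≤ r) (ht : 0 ≤ t) :
    ENNReal.ofReal r * ∫⁻ s in Icc 0 t, ENNReal.ofReal (Real.exp (-r * s)) =
      ENNReal.ofReal (1 - Real.exp (-r * t)) := by
  rw [← lintegral_const_mul _ (by fun_prop)]
  simp_rw [← ENNReal.ofReal_mul hr]
  have hd : ∀ s, HasDerivAt (fun s => -Real.exp (-r * s)) (r * Real.exp (-r * s)) s := by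
    intro s
    exact (((hasDerivAt_id' s).const_mul (-r)).exp.neg).congr_deriv (by ring)
  rw [setLIntegral_ofReal_Icc ht hd (by fun_prop) (fun s _ => by positivity)]
  congr 1
  simp; ring

theorem expPos_lconvolution (a b t : ℝ) :
    (expPos a ⋆ₗ expPos b) t = ENNReal.ofReal (Real.exp (b * t)) *
      ∫⁻ s in Icc 0 t, ENNReal.ofReal (Real.exp (-(b - a) * s)) := by
  rw [lconvolution_eq_setLIntegral (fun s => expPos_of_neg a) (fun s => expPos_of_neg b),
    ← lintegral_const_mul _ (by fun_prop)]
  refine setLIntegral_congr_fun measurableSet_Icc fun s hs => ?_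
  rw [expPos_of_nonneg a hs.1, expPos_of_nonneg b (by linarith [hs.2]),
    ← ENNReal.ofReal_mul (by positivity), ← ENNReal.ofReal_mul (by positivity), ← Real.exp_add,
    ← Real.exp_add]
  ring_nf

theorem lconvolution_of_neg {f g : ℝ → ℝ≥0∞} (hf : ∀ s < 0, f s = 0) (hg : ∀ s < 0, g s = 0)
    {t : ℝ} (ht : t < 0) : (f ⋆ₗ g) t = 0 := by
  rw [lconvolution_eq_setLIntegral hf hg, Icc_eq_empty (by linarith)]
  simp

/-- Holding at a larger exponential rate and restarting at each of the superfluous rings. -/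
theorem expPos_add {a j : ℝ} (hj : 0 ≤ j) (t : ℝ) :
    expPos (a + j) t = expPos a t + ENNReal.ofReal j * (expPos a ⋆ₗ expPos (a + j)) t := by
  rcases lt_or_ge t 0 with ht | ht
  · rw [expPos_of_neg _ ht, expPos_of_neg _ ht,
      lconvolution_of_neg (fun s => expPos_of_neg _) (fun s => expPos_of_neg _) ht]
    simp
  · rw [expPos_lconvolution, expPos_of_nonneg _ ht, expPos_of_nonneg _ ht, mul_left_comm,
      add_sub_cancel_left, ofReal_mul_setLIntegral_exp hj ht, ← ENNReal.ofReal_mul (by positivity),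
      ← ENNReal.ofReal_add (by positivity), mul_sub, ← Real.exp_add]
    · ring_nf
    · refine mul_nonneg (by positivity) (sub_nonneg.2 (Real.exp_le_one_iff.2 ?_))
      nlinarith

end Exponential

/-! ### Backward and forward equations of the minimal transition function -/

section Recursions

variable {S : Type*}

open Classical in
/-- The diagonal kernel of the holding times: `e^{a(x) t}` at `(x, x)`. -/
noncomputable def holdKer (a : S → ℝ) : TimeKernel S :=
  fun x y => if x = y then expPos (a x) else 0

open Classical in
/-- The diagonal matrix with entries `j x`. -/
noncomputable def diagMat (j : S → ℝ≥0∞) : S → S → ℝ≥0∞ := fun x y => if x = y then j x else 0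

/-- `transBefore Q k` as a kernel of functions on the whole time line. -/
noncomputable def beforeKer (Q : S → S → ℝ) (k : ℕ) : TimeKernel S :=
  fun x y => (Ici 0).indicator fun t => transBefore Q k t x y

/-- `trans Q` as a kernel of functions on the whole time line. -/
noncomputable def transKer (Q : S → S → ℝ) : TimeKernel S :=
  fun x y => (Ici 0).indicator fun t => trans Q t x y

theorem measurable_holdKer (a : S → ℝ) (x y : S) : Measurable (holdKer a x y) := by
  unfold holdKer; split_ifs <;> fun_prop

theorem beforeKer_of_nonneg (Q : S → S → ℝ) (k : ℕ) (x y : S) {t : ℝ} (ht : 0 ≤ t) :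
    beforeKer Q k x y t = transBefore Q k t x y := indicator_of_mem (by exact ht) _

theorem beforeKer_of_neg (Q : S → S → ℝ) (k : ℕ) (x y : S) {t : ℝ} (ht : t < 0) :
    beforeKer Q k x y t = 0 := indicator_of_notMem (by simpa using ht) _

theorem transKer_of_nonneg (Q : S → S → ℝ) (x y : S) {t : ℝ} (ht : 0 ≤ t) :
    transKer Q x y t = trans Q t x y := indicator_of_mem (by exact ht) _

theorem transKer_of_neg (Q : S → S → ℝ) (x y : S) {t : ℝ} (ht : t < 0) :
    transKer Q x y t = 0 := indicator_of_notMem (by simpa using ht) _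

theorem beforeKer_zero (Q : S → S → ℝ) : beforeKer Q 0 = 0 := by
  funext x y t
  simp [beforeKer, transBefore, indicator]

theorem kerConv_holdKer_left (a : S → ℝ) (J : S → S → ℝ≥0∞) (L : TimeKernel S) (x y : S) (t : ℝ) :
    kerConv (holdKer a) J L x y t = ∑' w, J x w * (expPos (a x) ⋆ₗ L w y) t := by
  unfold kerConv
  rw [tsum_eq_single x]
  · simp [holdKer]
  · intro w hw
    simp [holdKer, hw.symm]

theorem kerConv_holdKer_right (a : S → ℝ) (J : S → S → ℝ≥0∞) (L : TimeKernel S) (x y : S)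
    (t : ℝ) : kerConv L J (holdKer a) x y t = ∑' w, J w y * (L x w ⋆ₗ expPos (a y)) t := by
  unfold kerConv
  refine tsum_congr fun w => ?_
  rw [tsum_eq_single y]
  · simp [holdKer]
  · intro w' hw'
    simp [holdKer, hw']

theorem holdKer_add {a j : S → ℝ} (hj : ∀ x, 0 ≤ j x) :
    holdKer (a + j) = holdKer a +
      kerConv (holdKer a) (diagMat fun x => ENNReal.ofReal (j x)) (holdKer (a + j)) := by
  funext x y t
  rw [Pi.add_apply, Pi.add_apply, Pi.add_apply, kerConv_holdKer_left, tsum_eq_single x]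
  · by_cases h : x = y
    · simp [holdKer, h, diagMat, expPos_add (hj y)]
    · simp [holdKer, h]
  · intro w hw
    simp [diagMat, hw.symm]

variable [Countable S]

/-- The backward recursion `F_{k+1} = E + E J F_k`, with measurability in time. -/
theorem measurable_beforeKer_and_succ (Q : S → S → ℝ) (k : ℕ) :
    (∀ x y, Measurable (beforeKer Q k x y)) ∧
      beforeKer Q (k + 1) = holdKer (fun x => Q x x) +
        kerConv (holdKer fun x => Q x x) (jumpRate Q) (beforeKer Q k) := by
  have key : ∀ k, (∀ x y, Measurable (beforeKer Q k x y)) →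
      beforeKer Q (k + 1) = holdKer (fun x => Q x x) +
        kerConv (holdKer fun x => Q x x) (jumpRate Q) (beforeKer Q k) := by
    intro k hk
    funext x y t
    rw [Pi.add_apply, Pi.add_apply, Pi.add_apply, kerConv_holdKer_left]
    rcases lt_or_ge t 0 with ht | ht
    · rw [beforeKer_of_neg _ _ _ _ ht]
      have : ∀ w, (expPos (Q x x) ⋆ₗ beforeKer Q k w y) t = 0 := fun w =>
        lconvolution_of_neg (fun s => expPos_of_neg _) (fun s => beforeKer_of_neg _ _ _ _) ht
      simp only [this, mul_zero, tsum_zero, add_zero]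
      unfold holdKer
      split_ifs
      · rw [expPos_of_neg _ ht]
      · rfl
    · rw [beforeKer_of_nonneg _ _ _ _ ht, transBefore]
      congr 1
      · unfold holdKer
        split_ifs
        · rw [expPos_of_nonneg _ ht]
        · rfl
      · simp_rw [lconvolution_eq_setLIntegral (fun s => expPos_of_neg (Q x x))
          (fun s => beforeKer_of_neg Q k _ y)]
        have hm : ∀ w, Measurable fun s => expPos (Q x x) s * beforeKer Q k w y (t - s) := by
          intro w
          have := hk w y
          fun_prop
        simp_rw [← lintegral_const_mul _ (hm _)]
        rw [← lintegral_tsum fun w => ((hm w).const_mul _).aemeasurable]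
        refine setLIntegral_congr_fun measurableSet_Icc fun s hs => ?_
        rw [← ENNReal.tsum_mul_left]
        refine tsum_congr fun w => ?_
        rw [expPos_of_nonneg _ hs.1, beforeKer_of_nonneg _ _ _ _ (by linarith [hs.2]),
          mul_left_comm]
  have hmeas : ∀ k, ∀ x y, Measurable (beforeKer Q k x y) := by
    intro k
    induction k with
    | zero => intro x y; rw [beforeKer_zero]; exact measurable_const
    | succ k ih =>
      intro x y
      rw [key k ih]
      exact (measurable_holdKer _ x y).add
        (measurable_kerConv (measurable_holdKer _) ih x y)
  exact ⟨hmeas k, key k (hmeas k)⟩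

theorem measurable_beforeKer (Q : S → S → ℝ) (k : ℕ) (x y : S) : Measurable (beforeKer Q k x y) :=
  (measurable_beforeKer_and_succ Q k).1 x y

theorem beforeKer_succ (Q : S → S → ℝ) (k : ℕ) :
    beforeKer Q (k + 1) = holdKer (fun x => Q x x) +
        kerConv (holdKer fun x => Q x x) (jumpRate Q) (beforeKer Q k) :=
  (measurable_beforeKer_and_succ Q k).2

/-- The forward recursion `F_{k+1} = E + F_k J E`, by conditioning on the last jump. -/
theorem beforeKer_succ_forward (Q : S → S → ℝ) (k : ℕ) :
    beforeKer Q (k + 1) = holdKer (fun x => Q x x) +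
        kerConv (beforeKer Q k) (jumpRate Q) (holdKer fun x => Q x x) := by
  set E := holdKer fun x => Q x x with hE
  have mE : ∀ x y, Measurable (E x y) := measurable_holdKer _
  induction k with
  | zero => rw [beforeKer_succ, beforeKer_zero, kerConv_zero_left, kerConv_zero_right]
  | succ k ih =>
    rw [beforeKer_succ, ← hE]
    congr 1
    conv_lhs => rw [ih]
    rw [kerConv_add_right _ mE mE, kerConv_assoc _ _ mE (measurable_beforeKer Q k) mE,
      ← kerConv_add_left _ mE mE, hE, ← beforeKer_succ]

theorem beforeKer_mono (Q : S → S → ℝ) : Monotone (beforeKer Q) := by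
  refine monotone_nat_of_le_succ fun k => ?_
  induction k with
  | zero => rw [beforeKer_zero]; exact fun _ _ _ => zero_le
  | succ k ih =>
    rw [beforeKer_succ Q k, beforeKer_succ Q (k + 1)]
    exact add_le_add le_rfl (kerConv_mono le_rfl le_rfl ih)

omit [Countable S] in
theorem transKer_eq_iSup (Q : S → S → ℝ) :
    transKer Q = fun x y t => ⨆ k, beforeKer Q k x y t := by
  funext x y t
  rcases lt_or_ge t 0 with ht | ht
  · simp [transKer_of_neg _ _ _ ht, beforeKer_of_neg _ _ _ _ ht]
  · simp [transKer_of_nonneg _ _ _ ht, beforeKer_of_nonneg _ _ _ _ ht, trans]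

theorem measurable_transKer (Q : S → S → ℝ) (x y : S) : Measurable (transKer Q x y) := by
  rw [transKer_eq_iSup]
  exact Measurable.iSup fun k => measurable_beforeKer Q k x y

/-- The backward equation `P = E + E J P`. -/
theorem transKer_backward (Q : S → S → ℝ) :
    transKer Q = holdKer (fun x => Q x x) +
        kerConv (holdKer fun x => Q x x) (jumpRate Q) (transKer Q) := by
  rw [transKer_eq_iSup, kerConv_iSup_right _ (beforeKer_mono Q) (measurable_beforeKer Q)
    (measurable_holdKer _)]
  funext x y t
  simp only [Pi.add_apply]
  have hm : Monotone fun k => beforeKer Q k x y t := fun i j h => beforeKer_mono Q h x y t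
  rw [← hm.iSup_nat_add 1, ENNReal.add_iSup]
  refine iSup_congr fun k => ?_
  rw [beforeKer_succ]
  rfl

/-- If `Q = A + J`, where `J ≥ 0` may have diagonal entries `j`, then `P ≥ K + K J P` for the
transition functions `P` of `Q` and `K` of `A`: run the chain `A` up to the first jump of the
kind described by `J`. -/
theorem le_transKer_of_split {Q A : S → S → ℝ} {J : S → S → ℝ≥0∞} {j : S → ℝ}
    (hj : ∀ x, 0 ≤ j x) (hdiag : ∀ x, Q x x = A x x + j x)
    (hJ : jumpRate A + J = jumpRate Q + diagMat fun x => ENNReal.ofReal (j x)) :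
    transKer A + kerConv (transKer A) J (transKer Q) ≤ transKer Q := by
  set P := transKer Q with hP
  set EA := holdKer fun x => A x x with hEA
  set EQ := holdKer fun x => Q x x with hEQ
  set D := diagMat fun x => ENNReal.ofReal (j x) with hD
  have mP : ∀ x y, Measurable (P x y) := measurable_transKer Q
  have mEA : ∀ x y, Measurable (EA x y) := measurable_holdKer _
  have mEQ : ∀ x y, Measurable (EQ x y) := measurable_holdKer _
  have hE : EQ = EA + kerConv EA D EQ := by
    have : (fun x => Q x x) = (fun x => A x x) + j := funext hdiag
    rw [hEQ, this]
    exact holdKer_add hj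
  have hPQ : P = EQ + kerConv EQ (jumpRate Q) P := transKer_backward Q
  have hPA : P = EA + kerConv EA (jumpRate A + J) P := by
    rw [hJ, kerConv_add_mid]
    have : kerConv EA D P = kerConv EA D EQ + kerConv (kerConv EA D EQ) (jumpRate Q) P := by
      conv_lhs => rw [hPQ]
      rw [kerConv_add_right _ mEA mEQ, kerConv_assoc _ _ mEA mEQ mP]
    rw [this]
    calc P = EQ + kerConv EQ (jumpRate Q) P := hPQ
      _ = (EA + kerConv EA D EQ) + kerConv (EA + kerConv EA D EQ) (jumpRate Q) P := by rw [← hE]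
      _ = _ := by rw [kerConv_add_left _ mEA mP]; abel
  have hk : ∀ k, beforeKer A k + kerConv (beforeKer A k) J P ≤ P := by
    intro k
    induction k with
    | zero => rw [beforeKer_zero, kerConv_zero_left, add_zero]; exact fun _ _ _ => zero_le
    | succ k ih =>
      have mk := measurable_beforeKer A k
      rw [beforeKer_succ, kerConv_add_left _ mEA mP, ← kerConv_assoc _ _ mEA mk mP]
      calc _ = EA + (kerConv EA (jumpRate A) (beforeKer A k + kerConv (beforeKer A k) J P) +
                kerConv EA J P) := by
              rw [kerConv_add_right _ mEA mk]; abel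
        _ ≤ EA + (kerConv EA (jumpRate A) P + kerConv EA J P) :=
              add_le_add le_rfl (add_le_add (kerConv_mono le_rfl le_rfl ih) le_rfl)
        _ = P := by rw [← kerConv_add_mid, ← hPA]
  have hs : transKer A + kerConv (transKer A) J P = fun x y t =>
      ⨆ k, (beforeKer A k + kerConv (beforeKer A k) J P) x y t := by
    rw [transKer_eq_iSup, kerConv_iSup_left _ (beforeKer_mono A) (measurable_beforeKer A) mP]
    funext x y t
    simp only [Pi.add_apply]
    exact ENNReal.iSup_add_iSup_of_monotone (fun i j h => beforeKer_mono A h x y t)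
      fun i j h => kerConv_mono (beforeKer_mono A h) le_rfl le_rfl x y t
  rw [hs]
  exact fun x y t => iSup_le fun k => hk k x y t

omit [Countable S] in
/-- Shifting the diagonal of a rate matrix by `-r` multiplies its transition function by
`e^{-rt}`. -/
theorem trans_sub_diag {Q A : S → S → ℝ} {r : ℝ} (hdiag : ∀ x, A x x = Q x x - r)
    (hJ : jumpRate A = jumpRate Q) (t : ℝ) (x y : S) :
    trans A t x y = ENNReal.ofReal (Real.exp (-r * t)) * trans Q t x y := by
  have h : ∀ k t x y, transBefore A k t x y =
      ENNReal.ofReal (Real.exp (-r * t)) * transBefore Q k t x y := by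
    intro k
    induction k with
    | zero => simp [transBefore]
    | succ k ih =>
      intro t x y
      simp only [transBefore, hdiag, hJ, ih, mul_add]
      congr 1
      · split_ifs
        · rw [← ENNReal.ofReal_mul (by positivity), ← Real.exp_add]; ring_nf
        · simp
      · rw [← lintegral_const_mul' _ _ ENNReal.ofReal_ne_top]
        refine lintegral_congr fun s => ?_
        simp_rw [mul_left_comm (jumpRate Q x _), ENNReal.tsum_mul_left, ← mul_assoc,
          ← ENNReal.ofReal_mul (Real.exp_nonneg _), ← Real.exp_add]
        ring_nf
  simp only [trans, h, ENNReal.mul_iSup]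

/-- An invariant measure of the rate matrix is subinvariant for the minimal transition function. -/
theorem tsum_mul_trans_le {Q : S → S → ℝ} {v : S → ℝ≥0∞} (hQ : ∀ x, Q x x ≤ 0)
    (hv : ∀ y, ∑' x, v x * jumpRate Q x y = v y * ENNReal.ofReal (-Q y y)) {t : ℝ} (ht : 0 ≤ t)
    (y : S) : ∑' x, v x * trans Q t x y ≤ v y := by
  have hk : ∀ k y t, 0 ≤ t → ∑' x, v x * beforeKer Q k x y t ≤ v y := by
    intro k
    induction k with
    | zero => simp [beforeKer_zero]
    | succ k ih =>
      intro y t ht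
      have hm := measurable_beforeKer Q k
      rw [beforeKer_succ_forward]
      simp only [Pi.add_apply, mul_add, ENNReal.tsum_add, kerConv_holdKer_right]
      have h1 : ∑' x, v x * holdKer (fun x => Q x x) x y t
          = v y * ENNReal.ofReal (Real.exp (Q y y * t)) := by
        rw [tsum_eq_single y]
        · simp [holdKer, expPos_of_nonneg _ ht]
        · intro x hx; simp [holdKer, hx]
      have h2 : ∑' x, v x * ∑' w, jumpRate Q w y * (beforeKer Q k x w ⋆ₗ expPos (Q y y)) t
          ≤ v y * ENNReal.ofReal (1 - Real.exp (Q y y * t)) := by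
        calc _ = ∑' w, jumpRate Q w y * ∑' x, v x * (beforeKer Q k x w ⋆ₗ expPos (Q y y)) t := by
              simp_rw [← ENNReal.tsum_mul_left]
              rw [ENNReal.tsum_comm]
              simp_rw [mul_left_comm]
          _ ≤ ∑' w, jumpRate Q w y *
                (v w * ∫⁻ s in Icc 0 t, ENNReal.ofReal (Real.exp (Q y y * s))) := by
              refine ENNReal.tsum_le_tsum fun w => mul_le_mul' le_rfl ?_
              simp_rw [lconvolution_comm (f := beforeKer Q k _ w),
                lconvolution_eq_setLIntegral (fun s => expPos_of_neg (Q y y))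
                  (fun s => beforeKer_of_neg Q k _ w)]
              have hm' : ∀ x, Measurable fun s => expPos (Q y y) s * beforeKer Q k x w (t - s) :=
                fun x => by have := hm x w; fun_prop
              simp_rw [← lintegral_const_mul _ (hm' _)]
              rw [← lintegral_tsum fun x => ((hm' x).const_mul _).aemeasurable,
                ← lintegral_const_mul _ (by fun_prop)]
              refine setLIntegral_mono' measurableSet_Icc fun s hs => ?_
              simp_rw [mul_left_comm (v _), ENNReal.tsum_mul_left, expPos_of_nonneg _ hs.1]
              rw [mul_comm]
              exact mul_le_mul' (ih w (t - s) (by linarith [hs.2])) le_rfl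
          _ = v y * (ENNReal.ofReal (-Q y y) *
                ∫⁻ s in Icc 0 t, ENNReal.ofReal (Real.exp (Q y y * s))) := by
              simp_rw [← mul_assoc]
              rw [ENNReal.tsum_mul_right, ← hv y]
              simp_rw [mul_comm (v _)]
          _ = _ := by
              have := ofReal_mul_setLIntegral_exp (r := -Q y y) (by linarith [hQ y]) ht
              rw [neg_neg] at this
              rw [this]
      calc _ ≤ v y * ENNReal.ofReal (Real.exp (Q y y * t)) +
              v y * ENNReal.ofReal (1 - Real.exp (Q y y * t)) := add_le_add h1.le h2
        _ = v y := by
              rw [← mul_add, ← ENNReal.ofReal_add (by positivity)]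
              · simp
              · exact sub_nonneg.2 (Real.exp_le_one_iff.2 (mul_nonpos_of_nonpos_of_nonneg (hQ y) ht))
  have : ∀ x, v x * trans Q t x y = ⨆ k, v x * beforeKer Q k x y t := fun x => by
    rw [← transKer_of_nonneg _ _ _ ht, transKer_eq_iSup, ENNReal.mul_iSup]
  simp_rw [this]
  rw [tsum_iSup_of_monotone (fun k x => v x * beforeKer Q k x y t) fun x i j h => mul_le_mul' le_rfl (beforeKer_mono Q h x y t)]
  exact iSup_le fun k => hk k y t ht

end Recursions

/-! ### Laplace transforms at one -/

section Laplace

/-- The Laplace transform at `1` of a function that vanishes at negative times. -/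
noncomputable def laplaceOne (f : ℝ → ℝ≥0∞) : ℝ≥0∞ := ∫⁻ t, ENNReal.ofReal (Real.exp (-t)) * f t

theorem laplaceOne_mono {f g : ℝ → ℝ≥0∞} (h : ∀ t, f t ≤ g t) : laplaceOne f ≤ laplaceOne g :=
  lintegral_mono fun t => mul_le_mul' le_rfl (h t)

theorem laplaceOne_add {f g : ℝ → ℝ≥0∞} (hf : Measurable f) :
    laplaceOne (f + g) = laplaceOne f + laplaceOne g := by
  simp only [laplaceOne, Pi.add_apply, mul_add]
  exact lintegral_add_left (by fun_prop) _

theorem laplaceOne_const_mul {f : ℝ → ℝ≥0∞} (hf : Measurable f) (c : ℝ≥0∞) :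
    laplaceOne (fun t => c * f t) = c * laplaceOne f := by
  simp only [laplaceOne, mul_left_comm _ c]
  exact lintegral_const_mul _ (by fun_prop)

theorem laplaceOne_tsum {ι : Type*} [Countable ι] {f : ι → ℝ → ℝ≥0∞}
    (hf : ∀ i, Measurable (f i)) : laplaceOne (fun t => ∑' i, f i t) = ∑' i, laplaceOne (f i) := by
  simp only [laplaceOne, ← ENNReal.tsum_mul_left]
  exact lintegral_tsum fun i => by have := hf i; fun_prop

theorem laplaceOne_iSup {f : ℕ → ℝ → ℝ≥0∞} (hf : ∀ k, Measurable (f k)) (hm : Monotone f) :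
    laplaceOne (fun t => ⨆ k, f k t) = ⨆ k, laplaceOne (f k) := by
  simp only [laplaceOne, ENNReal.mul_iSup]
  exact lintegral_iSup (fun k => by have := hf k; fun_prop)
    fun i j h t => mul_le_mul' le_rfl (hm h t)

theorem laplaceOne_lconvolution {f g : ℝ → ℝ≥0∞} (hf : Measurable f) (hg : Measurable g) :
    laplaceOne (f ⋆ₗ g) = laplaceOne f * laplaceOne g := by
  simp only [laplaceOne, lconvolution_def]
  calc ∫⁻ t, ENNReal.ofReal (Real.exp (-t)) * ∫⁻ s, f s * g (-s + t)
      = ∫⁻ t, ∫⁻ s, ENNReal.ofReal (Real.exp (-t)) * (f s * g (-s + t)) :=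
        lintegral_congr fun t => (lintegral_const_mul _ (by fun_prop)).symm
    _ = ∫⁻ s, ∫⁻ t, ENNReal.ofReal (Real.exp (-t)) * (f s * g (-s + t)) :=
        lintegral_lintegral_swap (by fun_prop)
    _ = ∫⁻ s, ENNReal.ofReal (Real.exp (-s)) * f s *
          ∫⁻ u, ENNReal.ofReal (Real.exp (-u)) * g u := by
        refine lintegral_congr fun s => ?_
        rw [← lintegral_add_left_eq_self _ s, ← lintegral_const_mul _ (by fun_prop)]
        refine lintegral_congr fun u => ?_
        rw [neg_add_cancel_left, neg_add, Real.exp_add, ENNReal.ofReal_mul (by positivity)]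
        ring
    _ = _ := lintegral_mul_const _ (by fun_prop)

theorem lintegral_exp_Ioi {r : ℝ} (hr : 0 < r) (c : ℝ) :
    ∫⁻ s in Ioi c, ENNReal.ofReal (Real.exp (-r * s)) =
      ENNReal.ofReal (Real.exp (-r * c) / r) := by
  rw [← ofReal_integral_eq_lintegral_ofReal (integrableOn_exp_mul_Ioi (by linarith) c)
    (ae_of_all _ fun s => by positivity), integral_exp_mul_Ioi (by linarith)]
  congr 1
  field_simp

theorem laplaceOne_expPos {a : ℝ} (ha : a ≤ 0) :
    laplaceOne (expPos a) = (1 + ENNReal.ofReal (-a))⁻¹ := by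
  have h : ∀ t, ENNReal.ofReal (Real.exp (-t)) * expPos a t =
      (Ici 0).indicator (fun t => ENNReal.ofReal (Real.exp (-(1 - a) * t))) t := by
    intro t
    rcases lt_or_ge t 0 with ht | ht
    · rw [expPos_of_neg _ ht, indicator_of_notMem (by simpa using ht), mul_zero]
    · rw [expPos_of_nonneg _ ht, indicator_of_mem (by exact ht),
        ← ENNReal.ofReal_mul (by positivity), ← Real.exp_add]
      ring_nf
  simp only [laplaceOne, h]
  rw [lintegral_indicator measurableSet_Ici, setLIntegral_congr Ioi_ae_eq_Ici.symm,
    lintegral_exp_Ioi (by linarith), ← ENNReal.ofReal_one, ← ENNReal.ofReal_add one_pos.le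
    (by linarith), ← ENNReal.ofReal_inv_of_pos (by linarith)]
  simp [sub_eq_add_neg]

end Laplace

/-! ### Explosion and the resolvent -/

section Mass

variable {S : Type*}

/-- Nonnegative total jump rates, equal to the sums of the rates out of a state. -/
structure IsConservative (Q : S → S → ℝ) : Prop where
  diag_nonpos : ∀ x, Q x x ≤ 0
  tsum_jumpRate : ∀ x, ∑' w, jumpRate Q x w = ENNReal.ofReal (-Q x x)

theorem IsRateMatrix.isConservative {Q : S → S → ℝ} (hQ : IsRateMatrix Q) : IsConservative Q := by
  classical
  have h : ∀ x, HasSum (Function.update (Q x) x 0) (-Q x x) := fun x => by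
    simpa using (hQ.row_sum x).update x 0
  have h0 : ∀ x y, 0 ≤ Function.update (Q x) x 0 y := fun x y => by
    by_cases hxy : y = x
    · simp [hxy]
    · simpa [hxy] using hQ.offDiag_nonneg x y (Ne.symm hxy)
  refine ⟨fun x => by linarith [(h x).nonneg (h0 x)], fun x => ?_⟩
  rw [← (h x).tsum_eq, ENNReal.ofReal_tsum_of_nonneg (h0 x) (h x).summable]
  refine tsum_congr fun y => ?_
  by_cases hxy : x = y
  · simp [jumpRate, hxy]
  · simp [jumpRate, hxy, Ne.symm hxy]

/-- The probability of fewer than `k` jumps up to time `t`. -/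
noncomputable def beforeMass (Q : S → S → ℝ) (k : ℕ) (x : S) (t : ℝ) : ℝ≥0∞ :=
  ∑' y, beforeKer Q k x y t

/-- The kernel of the resolvent at `1`, restricted to fewer than `k` jumps. -/
noncomputable def beforeRes (Q : S → S → ℝ) (k : ℕ) (x y : S) : ℝ≥0∞ :=
  laplaceOne (beforeKer Q k x y)

/-- The kernel of the resolvent at `1` of the minimal transition function. -/
noncomputable def resolvent (Q : S → S → ℝ) (x y : S) : ℝ≥0∞ := laplaceOne (transKer Q x y)

variable [Countable S]

theorem measurable_beforeMass (Q : S → S → ℝ) (k : ℕ) (x : S) : Measurable (beforeMass Q k x) :=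
  Measurable.tsum fun y => measurable_beforeKer Q k x y

theorem monotone_beforeMass (Q : S → S → ℝ) (x : S) (t : ℝ) :
    Monotone fun k => beforeMass Q k x t :=
  fun _ _ h => ENNReal.tsum_le_tsum fun y => beforeKer_mono Q h x y t

theorem tsum_transKer (Q : S → S → ℝ) (x : S) (t : ℝ) :
    ∑' y, transKer Q x y t = ⨆ k, beforeMass Q k x t := by
  rw [transKer_eq_iSup]
  exact tsum_iSup_of_monotone _ fun y i j h => beforeKer_mono Q h x y t

theorem beforeMass_succ (Q : S → S → ℝ) (k : ℕ) (x : S) {t : ℝ} (ht : 0 ≤ t) :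
    beforeMass Q (k + 1) x t = ENNReal.ofReal (Real.exp (Q x x * t)) +
      ∫⁻ s in Icc 0 t, ENNReal.ofReal (Real.exp (Q x x * s)) *
        ∑' w, jumpRate Q x w * beforeMass Q k w (t - s) := by
  unfold beforeMass
  rw [beforeKer_succ]
  simp only [Pi.add_apply, ENNReal.tsum_add, kerConv_holdKer_left]
  congr 1
  · rw [tsum_eq_single x]
    · simp [holdKer, expPos_of_nonneg _ ht]
    · intro y hy; simp [holdKer, hy.symm]
  · have hm : ∀ w y, Measurable fun s => expPos (Q x x) s * beforeKer Q k w y (t - s) := by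
      intro w y
      have := measurable_beforeKer Q k w y
      fun_prop
    simp_rw [lconvolution_eq_setLIntegral (fun s => expPos_of_neg (Q x x))
      (fun s => beforeKer_of_neg Q k _ _), ← lintegral_const_mul _ (hm _ _)]
    simp_rw [← lintegral_tsum fun w => ((hm w _).const_mul _).aemeasurable]
    rw [← lintegral_tsum fun y => (Measurable.tsum fun w =>
      (hm w y).const_mul _).aemeasurable]
    refine setLIntegral_congr_fun measurableSet_Icc fun s hs => ?_
    rw [ENNReal.tsum_comm, ← ENNReal.tsum_mul_left]
    refine tsum_congr fun w => ?_
    rw [expPos_of_nonneg _ hs.1, ENNReal.tsum_mul_left, ENNReal.tsum_mul_left]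
    ring

theorem setLIntegral_exp_mul_rate {a : ℝ} (ha : a ≤ 0) {t : ℝ} (ht : 0 ≤ t) :
    ∫⁻ s in Icc 0 t, ENNReal.ofReal (Real.exp (a * s)) * ENNReal.ofReal (-a) =
      ENNReal.ofReal (1 - Real.exp (a * t)) := by
  have := ofReal_mul_setLIntegral_exp (r := -a) (by linarith) ht
  rw [neg_neg] at this
  rw [lintegral_mul_const _ (by fun_prop), mul_comm, this]

theorem ofReal_exp_add_one_sub {a t : ℝ} (ha : a ≤ 0) (ht : 0 ≤ t) :
    ENNReal.ofReal (Real.exp (a * t)) + ENNReal.ofReal (1 - Real.exp (a * t)) = 1 := by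
  rw [← ENNReal.ofReal_add (by positivity)
    (sub_nonneg.2 (Real.exp_le_one_iff.2 (mul_nonpos_of_nonpos_of_nonneg ha ht)))]
  simp

theorem beforeMass_le_one {Q : S → S → ℝ} (hQ : IsConservative Q) (k : ℕ) (x : S) (t : ℝ) :
    beforeMass Q k x t ≤ 1 := by
  rcases lt_or_ge t 0 with ht | ht
  · simp [beforeMass, beforeKer_of_neg _ _ _ _ ht]
  induction k generalizing x t with
  | zero => simp [beforeMass, beforeKer_zero]
  | succ k ih =>
    rw [beforeMass_succ Q k x ht, ← ofReal_exp_add_one_sub (hQ.diag_nonpos x) ht]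
    gcongr
    rw [← setLIntegral_exp_mul_rate (hQ.diag_nonpos x) ht, ← hQ.tsum_jumpRate x]
    refine setLIntegral_mono' measurableSet_Icc fun s hs => ?_
    gcongr with w
    exact (mul_le_mul' le_rfl (ih w (t - s) (by linarith [hs.2]))).trans_eq (mul_one _)

theorem tsum_trans_le_one {Q : S → S → ℝ} (hQ : IsConservative Q) (x : S) {t : ℝ} (ht : 0 ≤ t) :
    ∑' y, trans Q t x y ≤ 1 := by
  simp_rw [← transKer_of_nonneg Q x _ ht]
  rw [tsum_transKer]
  exact iSup_le fun k => beforeMass_le_one hQ k x t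

theorem beforeMass_antitoneOn {Q : S → S → ℝ} (hQ : IsConservative Q) (k : ℕ) (x : S) {t t' : ℝ}
    (ht : 0 ≤ t) (htt : t ≤ t') : beforeMass Q k x t' ≤ beforeMass Q k x t := by
  induction k generalizing x t t' with
  | zero => simp [beforeMass, beforeKer_zero]
  | succ k ih =>
    have hq := hQ.diag_nonpos x
    have hD : Disjoint (Icc 0 t) (Ioc t t') :=
      Set.disjoint_left.2 fun s hs hs' => absurd hs.2 (not_le.2 hs'.1)
    have hsplit : ∀ f : ℝ → ℝ≥0∞, ∫⁻ s in Icc 0 t', f s =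
        (∫⁻ s in Icc 0 t, f s) + ∫⁻ s in Ioc t t', f s := by
      intro f
      rw [← lintegral_union measurableSet_Ioc hD, Icc_union_Ioc_eq_Icc ht htt]
    rw [beforeMass_succ Q k x ht, beforeMass_succ Q k x (ht.trans htt), hsplit,
      add_left_comm, add_comm]
    -- the mass lost between `t` and `t'` is bounded by that of a first jump in this interval
    have h1 : ENNReal.ofReal (Real.exp (Q x x * t')) +
        ∫⁻ s in Ioc t t', ENNReal.ofReal (Real.exp (Q x x * s)) * ENNReal.ofReal (-Q x x) =
          ENNReal.ofReal (Real.exp (Q x x * t)) := by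
      have e' := ofReal_exp_add_one_sub hq (ht.trans htt)
      have e := ofReal_exp_add_one_sub hq ht
      rw [← setLIntegral_exp_mul_rate hq (ht.trans htt), hsplit, setLIntegral_exp_mul_rate hq ht,
        add_left_comm, ← e, add_comm] at e'
      exact (ENNReal.add_left_inj ENNReal.ofReal_ne_top).1 e'
    rw [← h1]
    refine add_le_add (add_le_add le_rfl ?_) ?_
    · refine setLIntegral_mono' measurableSet_Ioc fun s hs => mul_le_mul' le_rfl ?_
      rw [← hQ.tsum_jumpRate x]
      exact ENNReal.tsum_le_tsum fun w =>
        (mul_le_mul' le_rfl (beforeMass_le_one hQ k w _)).trans_eq (mul_one _)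
    · refine setLIntegral_mono' measurableSet_Icc fun s hs => mul_le_mul' le_rfl ?_
      exact ENNReal.tsum_le_tsum fun w =>
        mul_le_mul' le_rfl (ih w (by linarith [hs.2]) (by linarith))

omit [Countable S] in
theorem laplaceOne_holdKer {a : S → ℝ} (ha : ∀ x, a x ≤ 0) (x y : S) [Decidable (x = y)] :
    laplaceOne (holdKer a x y) = if x = y then (1 + ENNReal.ofReal (-a x))⁻¹ else 0 := by
  by_cases h : x = y
  · simp [holdKer, h, laplaceOne_expPos (ha _)]
  · simp [holdKer, h, laplaceOne]

open Classical in
theorem beforeRes_succ {Q : S → S → ℝ} (hQ : ∀ x, Q x x ≤ 0) (k : ℕ) (x y : S) :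
    beforeRes Q (k + 1) x y = (1 + ENNReal.ofReal (-Q x x))⁻¹ *
      ((if x = y then 1 else 0) + ∑' w, jumpRate Q x w * beforeRes Q k w y) := by
  have hm := measurable_beforeKer Q k
  unfold beforeRes
  rw [beforeKer_succ]
  have h : (holdKer (fun x => Q x x) + kerConv (holdKer fun x => Q x x) (jumpRate Q)
      (beforeKer Q k)) x y = holdKer (fun x => Q x x) x y +
        fun t => ∑' w, jumpRate Q x w * (expPos (Q x x) ⋆ₗ beforeKer Q k w y) t := by
    funext t
    simp only [Pi.add_apply, kerConv_holdKer_left]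
  have hc : ∀ w, Measurable (expPos (Q x x) ⋆ₗ beforeKer Q k w y) := fun w =>
    measurable_lconvolution _ (measurable_expPos _) (hm _ _)
  rw [h, laplaceOne_add (measurable_holdKer _ _ _), laplaceOne_holdKer (fun x => hQ x), mul_add,
    laplaceOne_tsum fun w => (hc w).const_mul _, ← ENNReal.tsum_mul_left]
  congr 1
  · simp
  · refine tsum_congr fun w => ?_
    rw [laplaceOne_const_mul (hc w), laplaceOne_lconvolution (measurable_expPos _) (hm _ _),
      laplaceOne_expPos (hQ x), mul_left_comm]

theorem laplaceOne_beforeMass (Q : S → S → ℝ) (k : ℕ) (x : S) :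
    laplaceOne (beforeMass Q k x) = ∑' y, beforeRes Q k x y :=
  laplaceOne_tsum fun y => measurable_beforeKer Q k x y

theorem laplaceOne_beforeMass_succ {Q : S → S → ℝ} (hQ : ∀ x, Q x x ≤ 0) (k : ℕ) (x : S) :
    laplaceOne (beforeMass Q (k + 1) x) = (1 + ENNReal.ofReal (-Q x x))⁻¹ *
      (1 + ∑' w, jumpRate Q x w * laplaceOne (beforeMass Q k w)) := by
  classical
  simp_rw [laplaceOne_beforeMass, beforeRes_succ hQ]
  rw [ENNReal.tsum_mul_left, ENNReal.tsum_add, ENNReal.tsum_comm]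
  simp_rw [ENNReal.tsum_mul_left]
  rw [tsum_ite_eq']

theorem one_add_ofReal_ne_zero (a : ℝ) : 1 + ENNReal.ofReal a ≠ 0 := by simp

theorem one_add_ofReal_ne_top (a : ℝ) : 1 + ENNReal.ofReal a ≠ ∞ := by simp

/-- The chain does not explode if no nonzero bounded function `φ ≥ 0` is subharmonic for the
chain killed at rate one. -/
theorem tsum_trans_eq_one_of_forall {Q : S → S → ℝ} (hQ : IsConservative Q)
    (h : ∀ φ : S → ℝ≥0∞, (∀ x, φ x ≤ 1) →
      (∀ x, (1 + ENNReal.ofReal (-Q x x)) * φ x ≤ ∑' w, jumpRate Q x w * φ w) → ∀ x, φ x = 0)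
    {t : ℝ} (ht : 0 ≤ t) (x : S) : ∑' y, trans Q t x y = 1 := by
  have hmono : ∀ x, Monotone fun k => laplaceOne (beforeMass Q k x) := fun x i j hij =>
    laplaceOne_mono fun t => monotone_beforeMass Q x t hij
  set L : S → ℝ≥0∞ := fun x => ⨆ k, laplaceOne (beforeMass Q k x) with hL
  have hL1 : ∀ x, L x ≤ 1 := by
    refine fun x => iSup_le fun k => ?_
    calc laplaceOne (beforeMass Q k x) ≤ laplaceOne (expPos 0) := by
          refine laplaceOne_mono fun t => ?_
          rcases lt_or_ge t 0 with ht | ht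
          · simp [beforeMass, beforeKer_of_neg _ _ _ _ ht]
          · rw [expPos_of_nonneg _ ht]
            simpa using beforeMass_le_one hQ k x t
      _ = 1 := by rw [laplaceOne_expPos le_rfl]; simp
  have hrec : ∀ x, (1 + ENNReal.ofReal (-Q x x)) * L x = 1 + ∑' w, jumpRate Q x w * L w := by
    intro x
    have h1 : ∑' w, jumpRate Q x w * L w =
        ⨆ k, ∑' w, jumpRate Q x w * laplaceOne (beforeMass Q k w) := by
      simp_rw [hL, ENNReal.mul_iSup]
      exact tsum_iSup_of_monotone (fun k w => jumpRate Q x w * laplaceOne (beforeMass Q k w))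
        fun w i j hij => mul_le_mul' le_rfl (hmono w hij)
    rw [h1, ENNReal.add_iSup, hL]
    simp only
    rw [← (hmono x).iSup_nat_add 1, ENNReal.mul_iSup]
    refine iSup_congr fun k => ?_
    rw [laplaceOne_beforeMass_succ hQ.diag_nonpos, ← mul_assoc,
      ENNReal.mul_inv_cancel (one_add_ofReal_ne_zero _) (one_add_ofReal_ne_top _), one_mul]
  have hL2 : ∀ x, 1 ≤ L x := by
    have hφL : ∀ x, (1 - L x) + L x = 1 := fun x => tsub_add_cancel_of_le (hL1 x)
    refine fun x => tsub_eq_zero_iff_le.1 (h (fun x => 1 - L x) (fun x => tsub_le_self) ?_ x)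
    intro x
    have hfin : (1 + ENNReal.ofReal (-Q x x)) * L x ≠ ∞ :=
      ENNReal.mul_ne_top (one_add_ofReal_ne_top _) (ne_top_of_le_ne_top ENNReal.one_ne_top (hL1 x))
    refine le_of_eq ((ENNReal.add_left_inj hfin).1 ?_)
    rw [← mul_add, hφL, mul_one, hrec x, add_left_comm, ← ENNReal.tsum_add]
    simp_rw [← mul_add, hφL, mul_one, hQ.tsum_jumpRate]
  -- the mass is a decreasing function of time with the Laplace transform of the constant one
  refine le_antisymm (tsum_trans_le_one hQ x ht) ?_
  simp_rw [← transKer_of_nonneg Q x _ ht]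
  rw [tsum_transKer]
  set b := ⨆ k, beforeMass Q k x t with hb
  have hupper : L x ≤ ENNReal.ofReal (1 - Real.exp (-1 * t)) +
      ENNReal.ofReal (Real.exp (-1 * t)) * b := by
    refine iSup_le fun k => ?_
    have hpt : ∀ s, ENNReal.ofReal (Real.exp (-s)) * beforeMass Q k x s ≤
        (Icc 0 t).indicator (fun s => ENNReal.ofReal (Real.exp (-1 * s))) s +
          (Ioi t).indicator (fun s => ENNReal.ofReal (Real.exp (-1 * s)) * b) s := by
      intro s
      rcases lt_or_ge s 0 with hs | hs
      · simp [beforeMass, beforeKer_of_neg _ _ _ _ hs]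
      rcases le_or_gt s t with hst | hst
      · have hmem : s ∈ Icc 0 t := ⟨hs, hst⟩
        rw [indicator_of_mem hmem]
        refine le_add_right ?_
        rw [neg_one_mul]
        exact (mul_le_mul' le_rfl (beforeMass_le_one hQ k x s)).trans_eq (mul_one _)
      · rw [indicator_of_mem (show s ∈ Ioi t from hst)]
        refine le_add_left ?_
        rw [neg_one_mul]
        exact mul_le_mul' le_rfl ((beforeMass_antitoneOn hQ k x ht hst.le).trans
          (le_iSup (fun k => beforeMass Q k x t) k))
    refine (lintegral_mono hpt).trans_eq ?_
    rw [lintegral_add_left (Measurable.indicator (by fun_prop) measurableSet_Icc),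
      lintegral_indicator measurableSet_Icc, lintegral_indicator measurableSet_Ioi,
      lintegral_mul_const _ (by fun_prop), lintegral_exp_Ioi one_pos, div_one]
    have := ofReal_mul_setLIntegral_exp (r := 1) one_pos.le ht
    rw [ENNReal.ofReal_one, one_mul] at this
    rw [this]
  have h1 := (hL2 x).trans hupper
  rw [← ofReal_exp_add_one_sub (by norm_num : (-1 : ℝ) ≤ 0) ht, add_comm,
    ENNReal.add_le_add_iff_left ENNReal.ofReal_ne_top] at h1
  have hpos : ENNReal.ofReal (Real.exp (-1 * t)) ≠ 0 := by simp [Real.exp_pos]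
  rw [← ENNReal.mul_le_mul_iff_right hpos ENNReal.ofReal_ne_top]
  simpa using h1

/-- Maximum principle for the resolvent of a chain that does not explode. -/
theorem le_resolvent_of_le {Q : S → S → ℝ} (hQ : IsConservative Q)
    (hone : ∀ t : ℝ, 0 ≤ t → ∀ x, ∑' y, trans Q t x y = 1) {φ ψ : S → ℝ≥0∞} (hφ : ∀ x, φ x ≤ 1)
    (h : ∀ x, (1 + ENNReal.ofReal (-Q x x)) * φ x ≤ ∑' w, jumpRate Q x w * φ w + ψ x) (x : S) :
    φ x ≤ ∑' y, resolvent Q x y * ψ y := by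
  classical
  have hk : ∀ k x, φ x + laplaceOne (beforeMass Q k x) ≤ 1 + ∑' y, beforeRes Q k x y * ψ y := by
    intro k
    induction k with
    | zero =>
      intro x
      have : laplaceOne (beforeMass Q 0 x) = 0 := by
        simp [laplaceOne, beforeMass, beforeKer_zero]
      rw [this, add_zero]
      exact (hφ x).trans le_self_add
    | succ k ih =>
      intro x
      have hne := one_add_ofReal_ne_zero (-Q x x)
      have hnt := one_add_ofReal_ne_top (-Q x x)
      rw [← ENNReal.mul_le_mul_iff_right hne hnt, mul_add, mul_add, mul_one,
        laplaceOne_beforeMass_succ hQ.diag_nonpos, ← mul_assoc, ENNReal.mul_inv_cancel hne hnt,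
        one_mul]
      have e : (1 + ENNReal.ofReal (-Q x x)) * ∑' y, beforeRes Q (k + 1) x y * ψ y =
          ψ x + ∑' w, jumpRate Q x w * ∑' y, beforeRes Q k w y * ψ y := by
        simp_rw [beforeRes_succ hQ.diag_nonpos, mul_assoc]
        rw [ENNReal.tsum_mul_left, ← mul_assoc, ENNReal.mul_inv_cancel hne hnt, one_mul]
        simp_rw [add_mul, ← ENNReal.tsum_mul_left, ← ENNReal.tsum_mul_right]
        rw [ENNReal.tsum_add, ENNReal.tsum_comm]
        congr 1
        · rw [tsum_eq_single x]
          · simp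
          · intro y hy; simp [hy.symm]
        · simp_rw [mul_assoc]
      rw [e]
      calc _ ≤ (∑' w, jumpRate Q x w * φ w + ψ x) +
              (1 + ∑' w, jumpRate Q x w * laplaceOne (beforeMass Q k w)) :=
            add_le_add (h x) le_rfl
        _ = (∑' w, jumpRate Q x w * (φ w + laplaceOne (beforeMass Q k w))) + (1 + ψ x) := by
            simp_rw [mul_add]; rw [ENNReal.tsum_add]; ring
        _ ≤ (∑' w, jumpRate Q x w * (1 + ∑' y, beforeRes Q k w y * ψ y)) + (1 + ψ x) :=
            add_le_add (ENNReal.tsum_le_tsum fun w => mul_le_mul' le_rfl (ih w)) le_rfl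
        _ = _ := by
            simp_rw [mul_add, mul_one]; rw [ENNReal.tsum_add, hQ.tsum_jumpRate]; ring
  have hL : ⨆ k, laplaceOne (beforeMass Q k x) = 1 := by
    rw [← laplaceOne_iSup (fun k => measurable_beforeMass Q k x)
      fun i j hij t => monotone_beforeMass Q x t hij]
    have : (fun t => ⨆ k, beforeMass Q k x t) = expPos 0 := by
      funext t
      rw [← tsum_transKer]
      rcases lt_or_ge t 0 with ht | ht
      · simp [transKer_of_neg _ _ _ ht, expPos_of_neg _ ht]
      · simp [transKer_of_nonneg _ _ _ ht, expPos_of_nonneg _ ht, hone t ht x]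
    rw [this, laplaceOne_expPos le_rfl]
    simp
  have hle : ∀ k, φ x + laplaceOne (beforeMass Q k x) ≤ 1 + ∑' y, resolvent Q x y * ψ y := by
    refine fun k => (hk k x).trans (add_le_add le_rfl (ENNReal.tsum_le_tsum fun y =>
      mul_le_mul' (laplaceOne_mono fun t => ?_) le_rfl))
    rw [transKer_eq_iSup]
    exact le_iSup (fun k => beforeKer Q k x y t) k
  have := iSup_le hle
  rw [← ENNReal.add_iSup, hL, add_comm, ENNReal.add_le_add_iff_left ENNReal.one_ne_top] at this
  exact this

theorem tsum_mul_resolvent_le {Q : S → S → ℝ} {v : S → ℝ≥0∞} (hQ : ∀ x, Q x x ≤ 0)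
    (hv : ∀ y, ∑' x, v x * jumpRate Q x y = v y * ENNReal.ofReal (-Q y y)) (y : S) :
    ∑' x, v x * resolvent Q x y ≤ v y := by
  have hm := measurable_transKer Q
  simp_rw [resolvent, ← laplaceOne_const_mul (hm _ _)]
  rw [← laplaceOne_tsum fun x => (hm x y).const_mul _]
  calc _ ≤ laplaceOne (fun t => v y * expPos 0 t) := by
        refine laplaceOne_mono fun t => ?_
        rcases lt_or_ge t 0 with ht | ht
        · simp [transKer_of_neg _ _ _ ht]
        · simpa [transKer_of_nonneg _ _ _ ht, expPos_of_nonneg _ ht] using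
            tsum_mul_trans_le hQ hv ht y
    _ = v y := by
        rw [laplaceOne_const_mul (measurable_expPos _), laplaceOne_expPos le_rfl]; simp

/-- A positive recurrent chain has no nonzero bounded function `φ ≥ 0` with `κ φ ≤ Q φ` for a
positive `κ ≤ 1`, which need not be bounded away from zero. -/
theorem eq_zero_of_mul_le_generator {Q : S → S → ℝ} (hQ : IsConservative Q)
    (hone : ∀ t : ℝ, 0 ≤ t → ∀ x, ∑' y, trans Q t x y = 1) {v : S → ℝ≥0∞}
    (hv0 : ∀ x, v x ≠ 0) (hvsum : ∑' x, v x ≠ ∞)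
    (hv : ∀ y, ∑' x, v x * jumpRate Q x y = v y * ENNReal.ofReal (-Q y y)) {φ κ : S → ℝ≥0∞}
    (hφ : ∀ x, φ x ≤ 1) (hκ0 : ∀ x, κ x ≠ 0) (hκ1 : ∀ x, κ x ≤ 1)
    (h : ∀ x, (κ x + ENNReal.ofReal (-Q x x)) * φ x ≤ ∑' w, jumpRate Q x w * φ w) (x : S) :
    φ x = 0 := by
  have hκ : ∀ x, (1 - κ x) + κ x = 1 := fun x => tsub_add_cancel_of_le (hκ1 x)
  have h1 : ∀ x, φ x ≤ ∑' y, resolvent Q x y * ((1 - κ y) * φ y) := by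
    refine le_resolvent_of_le hQ hone hφ fun x => ?_
    calc (1 + ENNReal.ofReal (-Q x x)) * φ x
        = (κ x + ENNReal.ofReal (-Q x x)) * φ x + (1 - κ x) * φ x := by
          conv_lhs => rw [← hκ x]
          ring
      _ ≤ _ := add_le_add (h x) le_rfl
  -- integrate against the invariant measure
  have h2 : ∑' x, v x * φ x ≤ ∑' x, v x * ((1 - κ x) * φ x) := by
    calc ∑' x, v x * φ x ≤ ∑' x, v x * ∑' y, resolvent Q x y * ((1 - κ y) * φ y) :=
          ENNReal.tsum_le_tsum fun x => mul_le_mul' le_rfl (h1 x)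
      _ = ∑' y, (∑' x, v x * resolvent Q x y) * ((1 - κ y) * φ y) := by
          simp_rw [← ENNReal.tsum_mul_left, ← ENNReal.tsum_mul_right]
          rw [ENNReal.tsum_comm]
          simp_rw [mul_assoc]
      _ ≤ _ := ENNReal.tsum_le_tsum fun y =>
          mul_le_mul' (tsum_mul_resolvent_le hQ.diag_nonpos hv y) le_rfl
  have hfin : ∑' x, v x * φ x ≠ ∞ := ne_top_of_le_ne_top hvsum (ENNReal.tsum_le_tsum fun x =>
    (mul_le_mul' le_rfl (hφ x)).trans_eq (mul_one _))
  have h3 : ∑' x, v x * φ x =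
      ∑' x, v x * ((1 - κ x) * φ x) + ∑' x, v x * (κ x * φ x) := by
    rw [← ENNReal.tsum_add]
    refine tsum_congr fun x => ?_
    rw [← mul_add, ← add_mul, hκ, one_mul]
  have h4 : ∑' x, v x * (κ x * φ x) = 0 := by
    have hf' : ∑' x, v x * ((1 - κ x) * φ x) ≠ ∞ :=
      ne_top_of_le_ne_top hfin (h3 ▸ le_self_add)
    rw [h3] at h2
    have : ∑' x, v x * ((1 - κ x) * φ x) + ∑' x, v x * (κ x * φ x) ≤
        ∑' x, v x * ((1 - κ x) * φ x) + 0 := by simpa using h2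
    simpa using (ENNReal.add_le_add_iff_left hf').1 this
  have := ENNReal.tsum_eq_zero.1 h4 x
  simpa [hv0 x, hκ0 x] using this

end Mass

/-! ### Adding jumps of constant total rate -/

section Splitting

variable {S : Type*}

/-- The transition semigroup acting on nonnegative functions. -/
noncomputable def semi (Q : S → S → ℝ) (t : ℝ) (f : S → ℝ≥0∞) (x : S) : ℝ≥0∞ :=
  ∑' y, transKer Q x y t * f y

theorem semi_mono (Q : S → S → ℝ) (t : ℝ) {f g : S → ℝ≥0∞} (h : ∀ y, f y ≤ g y) (x : S) :
    semi Q t f x ≤ semi Q t g x :=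
  ENNReal.tsum_le_tsum fun y => mul_le_mul' le_rfl (h y)

theorem semi_add (Q : S → S → ℝ) (t : ℝ) (f g : S → ℝ≥0∞) (x : S) :
    semi Q t (fun y => f y + g y) x = semi Q t f x + semi Q t g x := by
  simp only [semi, mul_add, ENNReal.tsum_add]

theorem semi_const (Q : S → S → ℝ) (t : ℝ) (c : ℝ≥0∞) (x : S) :
    semi Q t (fun _ => c) x = semi Q t (fun _ => 1) x * c := by
  simp only [semi, ENNReal.tsum_mul_right, mul_one]

theorem semi_one (Q : S → S → ℝ) {t : ℝ} (ht : 0 ≤ t) (x : S) :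
    semi Q t (fun _ => 1) x = ∑' y, trans Q t x y := by
  simp only [semi, mul_one, transKer_of_nonneg _ _ _ ht]

/-- The rates of `Q` are those of `G` together with additional jumps `J` of constant total rate
`r`; of these, the rate `j x` belongs to jumps from `x` to itself. -/
structure IsSplitting (Q G : S → S → ℝ) (J : S → S → ℝ≥0∞) (r : ℝ) (j : S → ℝ) : Prop where
  rate_nonneg : 0 ≤ r
  self_nonneg : ∀ x, 0 ≤ j x
  diag : ∀ x, Q x x = G x x - r + j x
  jumpRate_add : jumpRate G + J = jumpRate Q + diagMat fun x => ENNReal.ofReal (j x)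
  tsum_jump : ∀ x, ∑' y, J x y = ENNReal.ofReal r

/-- The right-hand side of the renewal equation at the first jump of the kind described by `J`. -/
noncomputable def renewal (Q G : S → S → ℝ) (J : S → S → ℝ≥0∞) (r t : ℝ) (f : S → ℝ≥0∞) (x : S) :
    ℝ≥0∞ :=
  ENNReal.ofReal (Real.exp (-r * t)) * semi G t f x +
    ∫⁻ s in Icc 0 t, ENNReal.ofReal (Real.exp (-r * s)) *
      semi G s (fun w => ∑' w', J w w' * semi Q (t - s) f w') x

variable [Countable S]

theorem measurable_semi (Q : S → S → ℝ) (f : S → ℝ≥0∞) (x : S) :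
    Measurable fun t => semi Q t f x :=
  Measurable.tsum fun y => (measurable_transKer Q x y).mul_const _

theorem semi_one_antitone {Q : S → S → ℝ} (hQ : IsConservative Q) (x : S) {t t' : ℝ}
    (ht : 0 ≤ t) (htt : t ≤ t') :
    semi Q t' (fun _ => 1) x ≤ semi Q t (fun _ => 1) x := by
  simp only [semi, mul_one, tsum_transKer]
  exact iSup_mono fun k => beforeMass_antitoneOn hQ k x ht htt

theorem measurable_renewal_integrand (Q G : S → S → ℝ) (J : S → S → ℝ≥0∞) (r t : ℝ)
    (f : S → ℝ≥0∞) (x : S) :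
    Measurable fun s => ENNReal.ofReal (Real.exp (-r * s)) *
      semi G s (fun w => ∑' w', J w w' * semi Q (t - s) f w') x := by
  refine Measurable.mul (by fun_prop) (Measurable.tsum fun w => ?_)
  refine (measurable_transKer G x w).mul (Measurable.tsum fun w' => ?_)
  exact ((measurable_semi Q f w').comp (measurable_id.const_sub t)).const_mul _

theorem renewal_add (Q G : S → S → ℝ) (J : S → S → ℝ≥0∞) (r t : ℝ) (f g : S → ℝ≥0∞) (x : S) :
    renewal Q G J r t (fun y => f y + g y) x =
      renewal Q G J r t f x + renewal Q G J r t g x := by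
  unfold renewal
  simp only [semi_add, mul_add, ENNReal.tsum_add]
  rw [lintegral_add_left (measurable_renewal_integrand Q G J r t f x)]
  ring

variable {Q G : S → S → ℝ} {J : S → S → ℝ≥0∞} {r : ℝ} {j : S → ℝ}

theorem IsSplitting.renewal_le (h : IsSplitting Q G J r j) {t : ℝ} (ht : 0 ≤ t) (f : S → ℝ≥0∞)
    (x : S) : renewal Q G J r t f x ≤ semi Q t f x := by
  classical
  set A : S → S → ℝ := fun x y => G x y - if x = y then r else 0 with hA
  have hAd : ∀ x, A x x = G x x - r := fun x => by simp [hA]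
  have hAJ : jumpRate A = jumpRate G := by
    funext x y
    by_cases hxy : x = y <;> simp [jumpRate, hA, hxy]
  have hAt : ∀ {s : ℝ}, 0 ≤ s → ∀ y, transKer A x y s =
      ENNReal.ofReal (Real.exp (-r * s)) * transKer G x y s := fun hs y => by
    rw [transKer_of_nonneg _ _ _ hs, transKer_of_nonneg _ _ _ hs, trans_sub_diag hAd hAJ]
  have hle := le_transKer_of_split (Q := Q) (A := A) (J := J) h.self_nonneg
    (fun x => by rw [hAd, h.diag]) (by rw [hAJ, h.jumpRate_add])
  have key : renewal Q G J r t f x =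
      ∑' y, (transKer A + kerConv (transKer A) J (transKer Q)) x y t * f y := by
    simp only [Pi.add_apply, add_mul, ENNReal.tsum_add, renewal]
    congr 1
    · simp_rw [hAt ht, mul_assoc, ENNReal.tsum_mul_left]
      rfl
    · have hm : ∀ w w' y, Measurable fun s => transKer A x w s * transKer Q w' y (t - s) := by
        intro w w' y
        have h1 := measurable_transKer A x w
        have h2 := measurable_transKer Q w' y
        fun_prop
      simp only [kerConv, lconvolution_eq_setLIntegral (fun s => transKer_of_neg A x _)
        (fun s => transKer_of_neg Q _ _), ← lintegral_const_mul _ (hm _ _ _)]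
      simp_rw [← lintegral_tsum fun w' => ((hm _ w' _).const_mul _).aemeasurable]
      simp_rw [← lintegral_tsum fun w => (Measurable.tsum fun w' =>
        (hm w w' _).const_mul _).aemeasurable]
      have hm3 : ∀ y, Measurable fun s => ∑' w, ∑' w', J w w' *
          (transKer A x w s * transKer Q w' y (t - s)) := fun y =>
        Measurable.tsum fun w => Measurable.tsum fun w' => (hm w w' y).const_mul _
      simp_rw [← lintegral_mul_const _ (hm3 _)]
      rw [← lintegral_tsum fun y => ((hm3 y).mul_const _).aemeasurable]
      refine setLIntegral_congr_fun measurableSet_Icc fun s hs => ?_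
      simp only [hAt hs.1, semi]
      simp_rw [← ENNReal.tsum_mul_left, ← ENNReal.tsum_mul_right]
      symm
      rw [ENNReal.tsum_comm]
      refine tsum_congr fun w => ?_
      rw [ENNReal.tsum_comm]
      refine tsum_congr fun w' => tsum_congr fun y => ?_
      ring
  rw [key]
  exact ENNReal.tsum_le_tsum fun y => mul_le_mul' (hle x y t) le_rfl

/-- Adding jumps of constant total rate to a chain that does not explode yields a chain that does
not explode. -/
theorem IsSplitting.semi_one (h : IsSplitting Q G J r j) (hQ : IsConservative Q)
    (hG : ∀ t : ℝ, 0 ≤ t → ∀ x, semi G t (fun _ => 1) x = 1) {t : ℝ} (ht : 0 ≤ t) (x : S) :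
    semi Q t (fun _ => 1) x = 1 := by
  have hle1 : ∀ x, semi Q t (fun _ => 1) x ≤ 1 := fun x => by
    rw [InteractiveQueue.semi_one Q ht]; exact tsum_trans_le_one hQ x ht
  -- the smallest mass `b` satisfies `b ≥ e^{-rt} + (1 - e^{-rt}) b`
  set b := ⨅ x, semi Q t (fun _ => 1) x with hb
  have hb1 : b ≤ 1 := (iInf_le _ x).trans (hle1 x)
  have hb' : ENNReal.ofReal (Real.exp (-r * t)) + ENNReal.ofReal (1 - Real.exp (-r * t)) * b ≤ b := by
    refine le_iInf fun x => le_trans ?_ (h.renewal_le ht _ x)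
    unfold renewal
    rw [hG t ht, mul_one, ← ofReal_mul_setLIntegral_exp h.rate_nonneg ht, mul_comm _ b, ← mul_assoc,
      mul_comm (b * _), ← lintegral_mul_const _ (by fun_prop)]
    refine add_le_add le_rfl (setLIntegral_mono' measurableSet_Icc fun s hs =>
      mul_le_mul' le_rfl ?_)
    calc b * ENNReal.ofReal r = semi G s (fun _ => b * ENNReal.ofReal r) x := by
          rw [semi_const, hG s hs.1, one_mul]
      _ ≤ _ := by
          refine semi_mono _ _ (fun w => ?_) _
          rw [← h.tsum_jump w, mul_comm, ← ENNReal.tsum_mul_right]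
          exact ENNReal.tsum_le_tsum fun w' => mul_le_mul' le_rfl ((iInf_le _ w').trans
            (semi_one_antitone hQ w' (by linarith [hs.2]) (by linarith [hs.1])))
  have e := ofReal_exp_add_one_sub (a := -r) (by linarith [h.rate_nonneg]) ht
  have hfin : ENNReal.ofReal (1 - Real.exp (-r * t)) * b ≠ ∞ :=
    ENNReal.mul_ne_top ENNReal.ofReal_ne_top (ne_top_of_le_ne_top ENNReal.one_ne_top hb1)
  have h1 : ENNReal.ofReal (Real.exp (-r * t)) * 1 ≤ ENNReal.ofReal (Real.exp (-r * t)) * b := by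
    refine (ENNReal.add_le_add_iff_right hfin).1 ?_
    rwa [← add_mul, e, one_mul, mul_one]
  rw [ENNReal.mul_le_mul_iff_right (by simp [Real.exp_pos]) ENNReal.ofReal_ne_top] at h1
  exact le_antisymm (hle1 x) (h1.trans (iInf_le _ x))

omit [Countable S] in
theorem IsSplitting.renewal_one (h : IsSplitting Q G J r j)
    (hQ : ∀ t : ℝ, 0 ≤ t → ∀ x, semi Q t (fun _ => 1) x = 1) {x : S}
    (hG : ∀ t : ℝ, 0 ≤ t → semi G t (fun _ => 1) x = 1) {t : ℝ} (ht : 0 ≤ t) :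
    renewal Q G J r t (fun _ => 1) x = 1 := by
  have e := ofReal_exp_add_one_sub (a := -r) (by linarith [h.rate_nonneg]) ht
  refine Eq.trans ?_ e
  rw [renewal, hG t ht, mul_one, ← ofReal_mul_setLIntegral_exp h.rate_nonneg ht,
    mul_comm (ENNReal.ofReal r), ← lintegral_mul_const _ (by fun_prop)]
  congr 1
  refine setLIntegral_congr_fun measurableSet_Icc fun s hs => ?_
  have : (fun w => ∑' w', J w w' * semi Q (t - s) (fun _ => 1) w') = fun _ => ENNReal.ofReal r := by
    funext w
    simp_rw [hQ (t - s) (by linarith [hs.2]), mul_one, h.tsum_jump]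
  simp only [this]
  rw [semi_const, hG s hs.1, one_mul]

/-- The renewal equation at the first jump of the kind described by `J`. -/
theorem IsSplitting.semi_eq_renewal (h : IsSplitting Q G J r j)
    (hQ : ∀ t : ℝ, 0 ≤ t → ∀ x, semi Q t (fun _ => 1) x = 1) {x : S}
    (hG : ∀ t : ℝ, 0 ≤ t → semi G t (fun _ => 1) x = 1) {t : ℝ} (ht : 0 ≤ t) {f : S → ℝ≥0∞}
    (hf : ∀ y, f y ≤ 1) : semi Q t f x = renewal Q G J r t f x := by
  refine le_antisymm ?_ (h.renewal_le ht f x)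
  have hff : (fun y => f y + (1 - f y)) = fun _ => (1 : ℝ≥0∞) :=
    funext fun y => add_tsub_cancel_of_le (hf y)
  have e1 := renewal_add Q G J r t f (fun y => 1 - f y) x
  have e2 := semi_add Q t f (fun y => 1 - f y) x
  rw [hff, h.renewal_one hQ hG ht] at e1
  rw [hff, hQ t ht] at e2
  have hfin : semi Q t (fun y => 1 - f y) x ≠ ∞ :=
    ne_top_of_le_ne_top ENNReal.one_ne_top (le_add_self.trans_eq e2.symm)
  refine (ENNReal.add_le_add_iff_right hfin).1 ?_
  exact (e2.symm.trans e1).trans_le (add_le_add le_rfl (h.renewal_le ht _ x))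

end Splitting

/-! ### Chains with a level and an environment -/

section Levels

variable {D : Type*}

open Classical in
/-- The generator of a pair (level, environment): the level moves as an `M/M/1` queue whose rates
depend on the environment, and at level `n` the environment moves with generator `env n`. -/
noncomputable def levelGen (up down : D → ℝ) (env : ℕ → D → D → ℝ) (x y : ℕ × D) : ℝ :=
  (if x.2 = y.2 then mm1 (up x.2) (down x.2) x.1 y.1 else 0) +
    (if x.1 = y.1 then env x.1 x.2 y.2 else 0)

/-- The environment generators `ρ(z)^{-n} T n` of the queue. -/
noncomputable def queueEnv (lam mu : D → ℝ) (T : ℕ → D → D → ℝ) (n : ℕ) (z z' : D) : ℝ :=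
  ((lam z / mu z) ^ n)⁻¹ * T n z z'

theorem queueGen_eq_levelGen (lam mu : D → ℝ) (T : ℕ → D → D → ℝ) :
    queueGen lam mu T = levelGen lam mu (queueEnv lam mu T) := rfl

theorem levelGen_diag (up down : D → ℝ) (env : ℕ → D → D → ℝ) (n : ℕ) (z : D) :
    levelGen up down env (n, z) (n, z) =
      -(up z + if n = 0 then 0 else down z) + env n z z := by
  simp [levelGen, mm1]

open Classical in
theorem jumpRate_levelGen (up down : D → ℝ) (env : ℕ → D → D → ℝ) (n : ℕ) (z : D) (y : ℕ × D) :
    jumpRate (levelGen up down env) (n, z) y =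
      (if y = (n + 1, z) then ENNReal.ofReal (up z) else 0) +
      ((if y = (n - 1, z) then if n = 0 then 0 else ENNReal.ofReal (down z) else 0) +
      (if y.1 = n then jumpRate (env n) z y.2 else 0)) := by
  obtain ⟨n', z'⟩ := y
  simp only [jumpRate, levelGen, mm1, Prod.mk.injEq]
  by_cases hz : z = z'
  · subst hz
    by_cases h1 : n' = n + 1
    · subst h1
      have h2 : n + 1 ≠ n - 1 := by omega
      simp [h2]
    · by_cases h2 : n = n' + 1
      · subst h2
        simp [h1]
      · have h3 : n' = n - 1 → n = 0 := by omega
        by_cases h4 : n = n'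
        · subst h4
          by_cases h5 : n = n - 1
          · simp [h3 h5]
          · simp [h5]
        · have h5 : n' ≠ n - 1 := fun h => h4 (by omega)
          simp [h1, h2, h4, h5, Ne.symm h4]
  · by_cases h4 : n = n'
    · subst h4
      simp [hz, Ne.symm hz]
    · simp [h4, hz, Ne.symm hz, Ne.symm h4]

theorem tsum_prod_level {n : ℕ} (f : ℕ × D → ℝ≥0∞) :
    ∑' y : ℕ × D, (if y.1 = n then f y else 0) = ∑' z, f (n, z) := by
  rw [ENNReal.tsum_prod' (f := fun y : ℕ × D => if y.1 = n then f y else 0), tsum_eq_single n]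
  · simp
  · intro m hm; simp [hm]

theorem tsum_jumpRate_levelGen_mul (up down : D → ℝ) (env : ℕ → D → D → ℝ) (n : ℕ) (z : D)
    (f : ℕ × D → ℝ≥0∞) :
    ∑' y, jumpRate (levelGen up down env) (n, z) y * f y =
      ENNReal.ofReal (up z) * f (n + 1, z) +
      ((if n = 0 then 0 else ENNReal.ofReal (down z)) * f (n - 1, z) +
      ∑' z', jumpRate (env n) z z' * f (n, z')) := by
  simp only [jumpRate_levelGen, add_mul, ENNReal.tsum_add, ite_mul, zero_mul,
    tsum_ite_eq]
  rw [← tsum_prod_level (fun y => jumpRate (env n) z y.2 * f y)]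

theorem isConservative_levelGen {up down : D → ℝ} {env : ℕ → D → D → ℝ} (hup : ∀ z, 0 ≤ up z)
    (hdown : ∀ z, 0 ≤ down z) (henv : ∀ n, IsConservative (env n)) :
    IsConservative (levelGen up down env) := by
  have hd : ∀ n z, 0 ≤ if n = 0 then 0 else down z := fun n z => by
    split_ifs
    · exact le_rfl
    · exact hdown z
  constructor
  · rintro ⟨n, z⟩
    rw [levelGen_diag]
    linarith [hup z, hd n z, (henv n).diag_nonpos z]
  · rintro ⟨n, z⟩
    have := tsum_jumpRate_levelGen_mul up down env n z fun _ => 1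
    simp only [mul_one] at this
    rw [this, levelGen_diag, (henv n).tsum_jumpRate, neg_add, neg_neg,
      ENNReal.ofReal_add (add_nonneg (hup z) (hd n z)) (by linarith [(henv n).diag_nonpos z]),
      ENNReal.ofReal_add (hup z) (hd n z), add_assoc]
    congr 2
    split_ifs <;> simp

theorem jumpRate_queueEnv {lam mu : D → ℝ} {T : ℕ → D → D → ℝ} (hρ : ∀ z, 0 ≤ lam z / mu z)
    (n : ℕ) (z z' : D) : jumpRate (queueEnv lam mu T n) z z' =
      ENNReal.ofReal ((lam z / mu z) ^ n)⁻¹ * jumpRate (T n) z z' := by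
  unfold jumpRate queueEnv
  split_ifs
  · simp
  · rw [ENNReal.ofReal_mul (inv_nonneg.2 (pow_nonneg (hρ z) n))]

theorem isConservative_queueEnv {lam mu : D → ℝ} {T : ℕ → D → D → ℝ} (hρ : ∀ z, 0 ≤ lam z / mu z)
    (hT : ∀ n, IsConservative (T n)) (n : ℕ) : IsConservative (queueEnv lam mu T n) := by
  have h0 : ∀ z, 0 ≤ ((lam z / mu z) ^ n)⁻¹ := fun z => inv_nonneg.2 (pow_nonneg (hρ z) n)
  constructor
  · exact fun z => mul_nonpos_of_nonneg_of_nonpos (h0 z) ((hT n).diag_nonpos z)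
  · intro z
    simp_rw [jumpRate_queueEnv hρ]
    rw [ENNReal.tsum_mul_left, (hT n).tsum_jumpRate, ← ENNReal.ofReal_mul (h0 z), queueEnv,
      mul_neg]

open Classical in
/-- Arrivals completed by fictitious ones to total rate `lamBar`, and services (fictitious ones
if the queue is empty) at rate `θ`. -/
noncomputable def uniformJump (lam : D → ℝ) (lamBar θ : ℝ) (x y : ℕ × D) : ℝ≥0∞ :=
  (if y = (x.1 + 1, x.2) then ENNReal.ofReal (lam x.2) else 0) +
    ((if y = x then ENNReal.ofReal (lamBar - lam x.2) else 0) +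
    (if y = (x.1 - 1, x.2) then ENNReal.ofReal θ else 0))

theorem tsum_uniformJump_mul (lam : D → ℝ) (lamBar θ : ℝ) (n : ℕ) (z : D) (f : ℕ × D → ℝ≥0∞) :
    ∑' y, uniformJump lam lamBar θ (n, z) y * f y =
      ENNReal.ofReal (lam z) * f (n + 1, z) +
      (ENNReal.ofReal (lamBar - lam z) * f (n, z) + ENNReal.ofReal θ * f (n - 1, z)) := by
  simp only [uniformJump, add_mul, ENNReal.tsum_add, ite_mul, zero_mul, tsum_ite_eq]

/-- The queue is obtained from the pure-death chain with service rates `mu - θ` by adding the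
jumps `uniformJump`. -/
theorem isSplitting_levelGen {lam mu : D → ℝ} {lamBar θ : ℝ} (env : ℕ → D → D → ℝ)
    (hlam0 : ∀ z, 0 ≤ lam z) (hlamBar : 0 ≤ lamBar) (hlam : ∀ z, lam z ≤ lamBar) (hθ : 0 ≤ θ)
    (hmu : ∀ z, θ ≤ mu z) :
    IsSplitting (levelGen lam mu env) (levelGen 0 (fun z => mu z - θ) env)
      (uniformJump lam lamBar θ) (lamBar + θ)
      (fun x => lamBar - lam x.2 + if x.1 = 0 then θ else 0) := by
  have hj : ∀ x : ℕ × D, 0 ≤ if x.1 = 0 then θ else 0 := fun x => by split_ifs <;> simp [hθ]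
  refine ⟨by positivity, fun x => add_nonneg (sub_nonneg.2 (hlam _)) (hj x), ?_, ?_, ?_⟩
  · rintro ⟨n, z⟩
    rw [levelGen_diag, levelGen_diag]
    by_cases hn : n = 0
    · simp [hn]; ring
    · simp [hn]; ring
  · funext ⟨n, z⟩ y
    simp only [Pi.add_apply, jumpRate_levelGen, uniformJump, diagMat]
    rw [ENNReal.ofReal_add (sub_nonneg.2 (hlam _)) (hj (n, z))]
    by_cases hn : n = 0
    · subst hn
      by_cases hy : y = (0, z)
      · subst hy; simp
      · simp [hy, Ne.symm hy, add_comm]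
    · have hs : ENNReal.ofReal (mu z) = ENNReal.ofReal (mu z - θ) + ENNReal.ofReal θ := by
        rw [← ENNReal.ofReal_add (sub_nonneg.2 (hmu z)) hθ, sub_add_cancel]
      open Classical in
      have hself : (if (n, z) = y then ENNReal.ofReal (lamBar - lam z) else 0) =
          if y = (n, z) then ENNReal.ofReal (lamBar - lam z) else 0 := by
        by_cases hy : y = (n, z)
        · simp [hy]
        · simp [hy, Ne.symm hy]
      simp only [hn, if_false, hs, hself, add_zero, Pi.zero_apply, ENNReal.ofReal_zero, ite_self,
        zero_add]
      by_cases hy : y = (n - 1, z)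
      · simp only [hy, if_true]
        ring
      · simp only [hy, if_false]
        ring
  · rintro ⟨n, z⟩
    have := tsum_uniformJump_mul lam lamBar θ n z fun _ => 1
    simp only [mul_one] at this
    rw [this, ← add_assoc, ← ENNReal.ofReal_add (hlam0 z) (sub_nonneg.2 (hlam z)),
      ← ENNReal.ofReal_add (by linarith [hlam0 z]) hθ]
    congr 1; ring

theorem tsum_mul_jumpRate_levelGen (up down : D → ℝ) (env : ℕ → D → D → ℝ) (p : ℕ × D → ℝ≥0∞)
    (n : ℕ) (z : D) :
    ∑' x, p x * jumpRate (levelGen up down env) x (n, z) =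
      (if n = 0 then 0 else p (n - 1, z) * ENNReal.ofReal (up z)) +
      (p (n + 1, z) * ENNReal.ofReal (down z) +
      ∑' z', p (n, z') * jumpRate (env n) z' z) := by
  classical
  have h : ∀ x : ℕ × D, p x * jumpRate (levelGen up down env) x (n, z) =
      (if x = (n - 1, z) then if n = 0 then 0 else p x * ENNReal.ofReal (up z) else 0) +
      ((if x = (n + 1, z) then p x * ENNReal.ofReal (down z) else 0) +
      (if x.1 = n then p x * jumpRate (env n) x.2 z else 0)) := by
    rintro ⟨m, y⟩
    rw [jumpRate_levelGen, mul_add, mul_add]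
    congr 1
    · by_cases hy : y = z
      · subst hy
        by_cases hn : n = 0
        · simp [hn]
        · have : n = m + 1 ↔ m = n - 1 := by omega
          simp [hn, this]
      · simp [hy, Ne.symm hy]
    · congr 1
      · by_cases hy : y = z
        · subst hy
          by_cases hm : m = 0
          · simp [hm]
          · have : n = m - 1 ↔ m = n + 1 := by omega
            simp [hm, this]
        · simp [hy, Ne.symm hy]
      · by_cases hm : m = n
        · simp [hm]
        · simp [hm, Ne.symm hm]
  simp_rw [h, ENNReal.tsum_add]
  rw [tsum_ite_eq, tsum_ite_eq, tsum_prod_level (fun x => p x * jumpRate (env n) x.2 z)]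

/-- Without upward jumps the level does not increase. -/
theorem trans_levelGen_eq_zero (down : D → ℝ) (env : ℕ → D → D → ℝ) (t : ℝ) {x y : ℕ × D}
    (h : x.1 < y.1) : trans (levelGen 0 down env) t x y = 0 := by
  have hk : ∀ k t (x : ℕ × D), x.1 < y.1 → transBefore (levelGen 0 down env) k t x y = 0 := by
    intro k
    induction k with
    | zero => simp [transBefore]
    | succ k ih =>
      rintro t ⟨n, z⟩ hx
      have hne : (n, z) ≠ y := fun h => by rw [← h] at hx; exact lt_irrefl _ hx
      have h2 : ∀ s, transBefore (levelGen 0 down env) k (t - s) (n - 1, z) y = 0 :=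
        fun s => ih _ _ ((Nat.sub_le n 1).trans_lt hx)
      have h3 : ∀ s z', transBefore (levelGen 0 down env) k (t - s) (n, z') y = 0 :=
        fun s z' => ih _ _ hx
      simp [transBefore, hne, tsum_jumpRate_levelGen_mul, h2, h3]
  simp [trans, hk _ _ _ h]

/-- Without upward jumps the environment evolves at level zero with its own generator. -/
theorem trans_levelGen_zero (down : D → ℝ) (env : ℕ → D → D → ℝ) (t : ℝ) (z z' : D) :
    trans (levelGen 0 down env) t (0, z) (0, z') = trans (env 0) t z z' := by
  have hk : ∀ k t z, transBefore (levelGen 0 down env) k t (0, z) (0, z') =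
      transBefore (env 0) k t z z' := by
    intro k
    induction k with
    | zero => simp [transBefore]
    | succ k ih =>
      intro t z
      simp only [transBefore, tsum_jumpRate_levelGen_mul, ih, levelGen_diag]
      congr 1
      · by_cases hz : z = z' <;> simp [hz]
      · simp
  simp [trans, hk]

theorem semi_levelGen_zero (down : D → ℝ) (env : ℕ → D → D → ℝ) (t : ℝ) (f : ℕ × D → ℝ≥0∞)
    (z : D) : semi (levelGen 0 down env) t f (0, z) = semi (env 0) t (fun z' => f (0, z')) z := by
  rcases lt_or_ge t 0 with ht | ht
  · simp [semi, transKer_of_neg _ _ _ ht]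
  · simp only [semi, transKer_of_nonneg _ _ _ ht]
    rw [ENNReal.tsum_prod', tsum_eq_single 0]
    · simp_rw [trans_levelGen_zero]
    · intro n hn
      simp [trans_levelGen_eq_zero down env t (x := (0, z)) (y := (n, _)) (Nat.pos_of_ne_zero hn)]

end Levels

/-! ### The common invariant measure -/

section Invariant

variable {D : Type*} {T : ℕ → D → D → ℝ} {v : D → ℝ}

theorem IsCommonInvariant.tsum_mul_jumpRate (hv : IsCommonInvariant T v)
    (hT : ∀ n, IsRateMatrix (T n)) (n : ℕ) (z : D) :
    ∑' z', ENNReal.ofReal (v z') * jumpRate (T n) z' z =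
      ENNReal.ofReal (v z) * ENNReal.ofReal (-T n z z) := by
  classical
  have h := hv.balance n z
  rw [((hT n).row_sum z).tsum_eq, mul_zero] at h
  have h' := h.update z 0
  rw [zero_sub, add_zero] at h'
  have h0 : ∀ z', 0 ≤ Function.update (fun z' => v z' * T n z' z) z 0 z' := fun z' => by
    by_cases hz : z' = z
    · simp [hz]
    · simpa [hz] using mul_nonneg (hv.nonneg z') ((hT n).offDiag_nonneg z' z hz)
  rw [← ENNReal.ofReal_mul (hv.nonneg z), mul_neg, ← h'.tsum_eq,
    ENNReal.ofReal_tsum_of_nonneg h0 h'.summable]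
  refine tsum_congr fun z' => ?_
  by_cases hz : z' = z
  · simp [hz, jumpRate]
  · simp [hz, jumpRate, ENNReal.ofReal_mul (hv.nonneg z')]

theorem IsCommonInvariant.pos (hv : IsCommonInvariant T v) (hT : ∀ n, IsRateMatrix (T n))
    (hirr : IsIrreducible (T 0)) (z : D) : 0 < v z := by
  obtain ⟨z₀, hz₀⟩ := Function.ne_iff.1 hv.ne_zero
  induction hirr z₀ z with
  | refl => exact lt_of_le_of_ne (hv.nonneg _) (Ne.symm hz₀)
  | @tail a b _ hab ih =>
    refine lt_of_le_of_ne (hv.nonneg _) fun h0 => ?_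
    have h := hv.tsum_mul_jumpRate hT 0 b
    rw [← h0, ENNReal.ofReal_zero, zero_mul, ENNReal.tsum_eq_zero] at h
    have := h a
    simp [jumpRate, hab.1, not_le.2 ih, not_le.2 hab.2] at this

end Invariant

/-! ### Non-explosion of the death chain in the environment -/

section Nonexplosion

variable {D : Type*} [Countable D] {T : ℕ → D → D → ℝ} {v : D → ℝ}

/-- The pure-death chain in the interactive environment does not explode. At each level the
environment is a time change of a positive recurrent chain. -/
theorem semi_levelGen_queueEnv_one (hT : ∀ n, IsChainGenerator (T n))
    (hirr : IsIrreducible (T 0)) (hv : IsCommonInvariant T v) (hvs : Summable v)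
    {lam mu : D → ℝ} (hρ0 : ∀ z, 0 < lam z / mu z) (hρ1 : ∀ z, lam z / mu z ≤ 1) {d : D → ℝ}
    (hd : ∀ z, 0 ≤ d z) {t : ℝ} (ht : 0 ≤ t) (x : ℕ × D) :
    semi (levelGen 0 d (queueEnv lam mu T)) t (fun _ => 1) x = 1 := by
  have hTc : ∀ n, IsConservative (T n) := fun n => (hT n).toIsRateMatrix.isConservative
  have hTr : ∀ n, IsRateMatrix (T n) := fun n => (hT n).toIsRateMatrix
  have hG : IsConservative (levelGen 0 d (queueEnv lam mu T)) :=
    isConservative_levelGen (fun _ => le_rfl) hd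
      (isConservative_queueEnv (fun z => (hρ0 z).le) hTc)
  rw [semi_one _ ht]
  refine tsum_trans_eq_one_of_forall hG (fun φ hφ1 hφ => ?_) ht x
  suffices h : ∀ n z, φ (n, z) = 0 from fun x => h x.1 x.2
  intro n
  induction n using Nat.strong_induction_on with
  | _ n ih =>
  refine eq_zero_of_mul_le_generator (hTc n) (hT n).nonexplosive
    (v := fun z => ENNReal.ofReal (v z)) (κ := fun z => ENNReal.ofReal ((lam z / mu z) ^ n))
    (fun z => by simpa using hv.pos hTr hirr z)
    hvs.tsum_ofReal_ne_top (hv.tsum_mul_jumpRate hTr n) (fun z => hφ1 _)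
    (fun z => by simpa using pow_pos (hρ0 z) n)
    (fun z => by simpa using pow_le_one₀ (hρ0 z).le (hρ1 z)) fun z => ?_
  have h := hφ (n, z)
  rw [tsum_jumpRate_levelGen_mul, levelGen_diag] at h
  have hlow : (if n = 0 then 0 else ENNReal.ofReal (d z)) * φ (n - 1, z) = 0 := by
    by_cases hn : n = 0
    · simp [hn]
    · rw [ih (n - 1) (by omega), mul_zero]
  have hpos := pow_pos (hρ0 z) n
  have hinv : ENNReal.ofReal ((lam z / mu z) ^ n) * ENNReal.ofReal ((lam z / mu z) ^ n)⁻¹ = 1 := by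
    rw [← ENNReal.ofReal_mul hpos.le, mul_inv_cancel₀ hpos.ne', ENNReal.ofReal_one]
  rw [hlow] at h
  simp only [Pi.zero_apply, ENNReal.ofReal_zero, zero_mul, zero_add] at h
  simp_rw [jumpRate_queueEnv (fun z => (hρ0 z).le), mul_assoc, ENNReal.tsum_mul_left] at h
  have hdiag : ENNReal.ofReal ((lam z / mu z) ^ n)⁻¹ * ENNReal.ofReal (-T n z z) ≤
      ENNReal.ofReal (-(-(if n = 0 then 0 else d z) + queueEnv lam mu T n z z)) := by
    rw [← ENNReal.ofReal_mul (inv_nonneg.2 hpos.le)]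
    refine ENNReal.ofReal_le_ofReal ?_
    have : 0 ≤ if n = 0 then 0 else d z := by split_ifs; exacts [le_rfl, hd z]
    unfold queueEnv
    linarith
  calc (ENNReal.ofReal ((lam z / mu z) ^ n) + ENNReal.ofReal (-T n z z)) * φ (n, z)
      = ENNReal.ofReal ((lam z / mu z) ^ n) *
          ((1 + ENNReal.ofReal ((lam z / mu z) ^ n)⁻¹ * ENNReal.ofReal (-T n z z)) * φ (n, z)) := by
        rw [← mul_assoc, mul_add, ← mul_assoc, hinv, one_mul, mul_one]
    _ ≤ ENNReal.ofReal ((lam z / mu z) ^ n) * (ENNReal.ofReal ((lam z / mu z) ^ n)⁻¹ *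
          ∑' z', jumpRate (T n) z z' * φ (n, z')) :=
        mul_le_mul' le_rfl ((mul_le_mul' (add_le_add le_rfl hdiag) le_rfl).trans h)
    _ = ∑' z', jumpRate (T n) z z' * φ (n, z') := by
        rw [← mul_assoc, hinv, one_mul]

end Nonexplosion

/-! ### The coupling inequality -/

section Coupling

variable {D : Type u} [Countable D] [MeasurableSpace D] [DiscreteMeasurableSpace D]

theorem IsMarkovChainFrom.lintegral_comp {Ω : Type*} [MeasurableSpace Ω] {Q : D → D → ℝ} {x₀ : D}
    {Pr : Measure Ω} [IsProbabilityMeasure Pr] {Z : ℝ≥0 → Ω → D}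
    (h : IsMarkovChainFrom Q x₀ Pr Z) (t : ℝ≥0) (g : D → ℝ≥0∞) :
    ∫⁻ ω, g (Z t ω) ∂Pr = semi Q t g x₀ := by
  have h0 : ∀ᵐ ω ∂Pr, Z 0 ω = x₀ := by
    have := h.fdd 0 (fun _ => 0) (fun _ => x₀) monotone_const rfl
    simp only [Nat.le_zero, forall_eq, if_true, Finset.range_zero, Finset.prod_empty,
      mul_one] at this
    exact (mem_ae_iff_prob_eq_one (h.measurable 0 (measurableSet_singleton x₀))).2 this
  have hlaw : ∀ y, Pr (Z t ⁻¹' {y}) = trans Q t x₀ y := by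
    intro y
    have := h.fdd 1 (fun i => if i = 0 then 0 else t) (fun i => if i = 0 then x₀ else y)
      (by intro i j hij; by_cases hi : i = 0 <;> by_cases hj : j = 0 <;> simp [hi, hj]; omega) rfl
    simp only [if_true, Finset.range_one, Finset.prod_singleton, zero_add, one_ne_zero, if_false,
      NNReal.coe_zero, sub_zero, one_mul] at this
    rw [← this]
    refine measure_congr ?_
    filter_upwards [h0] with ω hω
    refine propext ⟨fun hy i hi => ?_, fun hy => ?_⟩
    · have hy' : Z t ω = y := hy
      interval_cases i
      · simpa using hω
      · simpa using hy'
    · change Z t ω = y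
      simpa using hy 1 le_rfl
  rw [← lintegral_map (f := g) (by measurability) (h.measurable t), lintegral_countable', semi]
  refine tsum_congr fun y => ?_
  rw [Measure.map_apply (h.measurable t) (measurableSet_singleton y), hlaw, mul_comm,
    transKer_of_nonneg _ _ _ (NNReal.coe_nonneg t)]

/-- The coupling inequality, in the form of a bound for the oscillation of `P^t g`. -/
theorem HasExpCoupling.semi_le {Q : D → D → ℝ} {α γ : ℝ} (h : HasExpCoupling.{u, w} Q α γ)
    {t : ℝ} (ht : 0 ≤ t) {g : D → ℝ≥0∞} {o : ℝ≥0∞} (hg : ∀ z z', g z ≤ g z' + o) (z₁ z₂ : D) :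
    semi Q t g z₁ ≤ semi Q t g z₂ + ENNReal.ofReal (α * Real.exp (-γ * t)) * o := by
  obtain ⟨Ω, _, Pr, Z₁, Z₂, τ, _, h1, h2, hτ, heq, htail⟩ := h z₁ z₂
  lift t to ℝ≥0 using ht
  have hg' : Measurable g := by measurability
  have hm : MeasurableSet {ω | (t : ℝ≥0∞) ≤ τ ω} := measurableSet_le measurable_const hτ
  rw [← h1.lintegral_comp t g, ← h2.lintegral_comp t g]
  calc ∫⁻ ω, g (Z₁ t ω) ∂Pr
      ≤ ∫⁻ ω, g (Z₂ t ω) + {ω | (t : ℝ≥0∞) ≤ τ ω}.indicator (fun _ => o) ω ∂Pr := by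
        refine lintegral_mono_ae ?_
        filter_upwards [heq] with ω hω
        by_cases hle : (t : ℝ≥0∞) ≤ τ ω
        · rw [indicator_of_mem (by exact hle)]
          exact hg _ _
        · rw [hω t (le_of_not_ge hle)]
          exact le_self_add
    _ = ∫⁻ ω, g (Z₂ t ω) ∂Pr + o * Pr {ω | (t : ℝ≥0∞) ≤ τ ω} := by
        have hgZ : Measurable fun ω => g (Z₂ t ω) := hg'.comp (h2.measurable t)
        rw [lintegral_add_left hgZ, lintegral_indicator_const hm]
    _ ≤ _ := by
        rw [mul_comm o]
        exact add_le_add le_rfl (mul_le_mul' (htail t) le_rfl)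

end Coupling

/-! ### The parameters of the bound -/

section Parameters

/-- The bound `min(1, α e^{-γ t})` for the probability that the coupling has not succeeded by
time `t`. -/
noncomputable def failBound (α γ t : ℝ) : ℝ := min 1 (α * Real.exp (-γ * t))

theorem failBound_nonneg {α : ℝ} (hα : 0 ≤ α) (γ t : ℝ) : 0 ≤ failBound α γ t :=
  le_min zero_le_one (by positivity)

theorem failBound_le_one (α γ t : ℝ) : failBound α γ t ≤ 1 := min_le_left _ _

@[fun_prop]
theorem continuous_failBound (α γ : ℝ) : Continuous (failBound α γ) := by
  unfold failBound; fun_prop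

theorem sq_lt_of_lt_cStar {l m c : ℝ} (hl : 0 < l) (hm : 0 < m) (hc0 : 0 ≤ c)
    (hc : c < cStar l m) : c ^ 2 < m / l := by
  have hsq : cStar l m ^ 2 = m / l := by
    rw [cStar, ← Real.rpow_natCast, ← Real.rpow_mul (by positivity)]
    norm_num
    rw [Real.rpow_neg_one, inv_div]
  rw [← hsq]
  gcongr

theorem mFun_nonneg {l m c : ℝ} (hl : 0 < l) (hlm : l < m) (hc : c ∈ Ioo 1 (cStar l m)) :
    0 ≤ mFun l m c := by
  obtain ⟨h1, h2⟩ := hc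
  have hm : 0 < m := hl.trans hlm
  have hc2 := sq_lt_of_lt_cStar hl hm (by linarith) h2
  have hlc : l * c ≤ m := by
    rw [lt_div_iff₀ hl] at hc2
    nlinarith
  have : mFun l m c = (c - 1) * (m - l * c) / c := by
    unfold mFun; field_simp; ring
  rw [this]
  exact div_nonneg (mul_nonneg (by linarith) (by linarith)) (by linarith)

/-- Concavity of `s ↦ m(e^s)`, which vanishes at `s = 0`. -/
theorem mFun_rpow_ge {l m c p : ℝ} (hl : 0 < l) (hm : 0 < m) (hc : 0 < c) (hp0 : 0 ≤ p)
    (hp1 : p ≤ 1) : p * mFun l m c ≤ mFun l m (c ^ p) := by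
  have h : ∀ b : ℝ, 0 < b → b ^ p ≤ p * b + (1 - p) := fun b hb => by
    simpa using Real.geom_mean_le_arith_mean2_weighted hp0 (sub_nonneg.2 hp1) hb.le zero_le_one
      (by ring)
  have h1 := h c hc
  have h2 := h c⁻¹ (inv_pos.2 hc)
  rw [Real.inv_rpow hc.le] at h2
  unfold mFun
  nlinarith [mul_le_mul_of_nonneg_left h1 hl.le, mul_le_mul_of_nonneg_left h2 hm.le]

/-- The integral of `β e^{(a-β)s} min(1, α e^{-γ s})` is the exponential moment of order `a` of an
exponential time of rate `β`, on the event that this time is exceeded by the coupling time. -/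
theorem lintegral_failBound_le {α β γ a : ℝ} (hα : 1 < α) (hβ : 0 < β) (hγ : 0 < γ)
    (ha : a < β + γ) :
    ∫⁻ s in Ioi 0, ENNReal.ofReal (β * (Real.exp ((a - β) * s) * failBound α γ s)) ≤
      ENNReal.ofReal (theta α β γ a - α ^ ((a - β) / γ) * (γ / (β + γ - a))) := by
  have hα0 : 0 < α := by linarith
  -- the time at which `α e^{-γ s}` drops below one
  set s₀ := Real.log α / γ with hs₀
  have hs₀0 : 0 ≤ s₀ := div_nonneg (Real.log_nonneg hα.le) hγ.le
  have hE : α ^ ((a - β) / γ) = Real.exp ((a - β) * s₀) := by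
    rw [Real.rpow_def_of_pos hα0, hs₀]; ring_nf
  have hαs : α * Real.exp (-γ * s₀) = 1 := by
    rw [hs₀, neg_mul, mul_div_cancel₀ _ hγ.ne', Real.exp_neg, Real.exp_log hα0,
      mul_inv_cancel₀ hα0.ne']
  have hAint : ∃ A, 0 ≤ A ∧ (∫⁻ s in Icc 0 s₀, ENNReal.ofReal (Real.exp ((a - β) * s))) =
      ENNReal.ofReal A ∧ β * A + β * (Real.exp ((a - β) * s₀) / (β + γ - a)) =
        theta α β γ a - α ^ ((a - β) / γ) * (γ / (β + γ - a)) := by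
    by_cases hab : a = β
    · refine ⟨s₀, hs₀0, by simp [hab], ?_⟩
      simp only [hab, theta, if_true, sub_self, zero_mul, zero_div, Real.exp_zero, Real.rpow_zero,
        hs₀, add_sub_cancel_left, div_self hγ.ne', one_mul]
      field_simp
      ring
    · have hab' : a - β ≠ 0 := sub_ne_zero.2 hab
      have hd : ∀ s, HasDerivAt (fun s => Real.exp ((a - β) * s) / (a - β))
          (Real.exp ((a - β) * s)) s := fun s =>
        ((((hasDerivAt_id' s).const_mul (a - β)).exp).div_const (a - β)).congr_deriv
          (by field_simp)
      have hI := setLIntegral_ofReal_Icc hs₀0 hd (by fun_prop) fun s _ => by positivity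
      refine ⟨_, ?_, hI, ?_⟩
      · rw [mul_zero, Real.exp_zero, ← sub_div]
        rcases lt_or_gt_of_ne hab' with h | h
        · refine div_nonneg_of_nonpos (sub_nonpos.2 (Real.exp_le_one_iff.2 ?_)) h.le
          exact mul_nonpos_of_nonpos_of_nonneg h.le hs₀0
        · exact div_nonneg (sub_nonneg.2 (Real.one_le_exp (by positivity))) h.le
      · rw [theta, if_neg hab, hE]
        have h1 : β + γ - a ≠ 0 := by linarith
        have h2 : β - a ≠ 0 := fun h => hab' (by linarith)
        rw [mul_zero, Real.exp_zero]
        field_simp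
        ring
  obtain ⟨A, hA0, hA, hsum⟩ := hAint
  have hB := lintegral_exp_Ioi (r := β + γ - a) (by linarith) s₀
  rw [← hsum, mul_div_assoc', ENNReal.ofReal_add (by positivity)
    (div_nonneg (by positivity) (by linarith)), ENNReal.ofReal_mul hβ.le, ← hA]
  have hBe : ENNReal.ofReal (β * Real.exp ((a - β) * s₀) / (β + γ - a)) =
      ∫⁻ s in Ioi s₀, ENNReal.ofReal (β * α) * ENNReal.ofReal (Real.exp (-(β + γ - a) * s)) := by
    rw [lintegral_const_mul _ (by fun_prop), hB, ← ENNReal.ofReal_mul (by positivity)]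
    congr 1
    have : Real.exp (-(β + γ - a) * s₀) = Real.exp ((a - β) * s₀) * Real.exp (-γ * s₀) := by
      rw [← Real.exp_add]; ring_nf
    rw [this]
    calc _ = β * Real.exp ((a - β) * s₀) * (α * Real.exp (-γ * s₀)) / (β + γ - a) := by
          rw [hαs, mul_one]
      _ = _ := by ring
  rw [hBe, ← lintegral_const_mul _ (by fun_prop)]
  have hsub : Ioi (0 : ℝ) ⊆ Icc 0 s₀ ∪ Ioi s₀ := fun s hs => by
    rcases le_or_gt s s₀ with h | h
    · exact Or.inl ⟨le_of_lt hs, h⟩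
    · exact Or.inr h
  refine (lintegral_mono_set hsub).trans ((lintegral_union_le _ _ _).trans (add_le_add ?_ ?_))
  · refine lintegral_mono fun s => ?_
    rw [← ENNReal.ofReal_mul hβ.le]
    refine ENNReal.ofReal_le_ofReal (mul_le_mul_of_nonneg_left ?_ hβ.le)
    exact mul_le_of_le_one_right (by positivity) (failBound_le_one _ _ _)
  · refine lintegral_mono fun s => ?_
    rw [← ENNReal.ofReal_mul (by positivity), mul_assoc]
    refine ENNReal.ofReal_le_ofReal (mul_le_mul_of_nonneg_left ?_ hβ.le)
    calc Real.exp ((a - β) * s) * failBound α γ s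
        ≤ Real.exp ((a - β) * s) * (α * Real.exp (-γ * s)) :=
          mul_le_mul_of_nonneg_left (min_le_right _ _) (by positivity)
      _ = _ := by
          rw [mul_left_comm, ← Real.exp_add]; ring_nf

theorem theta_zero {α β γ : ℝ} (hβ : 0 < β) : theta α β γ 0 = 1 := by
  simp [theta, hβ.ne, hβ.ne']

theorem failProb_mem_Ioo {α β γ : ℝ} (hα : 1 < α) (hβ : 0 < β) (hγ : 0 < γ) :
    1 - α ^ (-β / γ) * (γ / (β + γ)) ∈ Ioo (0 : ℝ) 1 := by
  have h1 : α ^ (-β / γ) < 1 :=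
    Real.rpow_lt_one_of_one_lt_of_neg hα (div_neg_of_neg_of_pos (by linarith) hγ)
  have h0 : 0 < α ^ (-β / γ) := Real.rpow_pos_of_pos (by linarith) _
  have h2 : 0 < γ / (β + γ) := by positivity
  have h3 : γ / (β + γ) < 1 := by rw [div_lt_one (by positivity)]; linarith
  constructor <;> nlinarith

/-- Admissibility makes the discounted probability of a failed coupling cycle smaller than one. -/
theorem Admissible.exists_contraction {l m α γ ε c : ℝ} (h : Admissible l m α γ ε c) (hα : 1 < α)
    (hl : 0 < l) (hγ : 0 < γ) :
    ∃ κ, 0 ≤ κ ∧ κ < 1 ∧ ∫⁻ s in Ioi 0, ENNReal.ofReal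
      (l * c ^ (1 - ε) * (Real.exp (((1 - ε) * mFun l m c - l) * s) * failBound α γ s)) ≤
        ENNReal.ofReal κ := by
  obtain ⟨hε0, hε1⟩ := h.eps_mem
  have hc : 1 < c := h.c_mem.1
  set M := mFun l m c with hM
  set q := 1 - α ^ (-l / γ) * (γ / (l + γ)) with hq
  obtain ⟨hq0, hq1⟩ := failProb_mem_Ioo hα hl hγ
  rw [← hq] at hq0 hq1
  set θ := theta α l γ M with hθ
  have hp : 0 < 1 - ε := by linarith
  have hfb := failBound_nonneg (by linarith : 0 ≤ α) γ
  have hI1 : ∫⁻ s in Ioi 0, ENNReal.ofReal (l * (Real.exp ((M - l) * s) * failBound α γ s)) ≤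
      ENNReal.ofReal (max θ 0) := by
    refine (lintegral_failBound_le hα hl hγ h.m_lt).trans (ENNReal.ofReal_le_ofReal ?_)
    refine le_max_of_le_left (sub_le_self _ ?_)
    exact mul_nonneg (Real.rpow_nonneg (by linarith) _) (div_nonneg hγ.le (by linarith [h.m_lt]))
  have hI0 : ∫⁻ s in Ioi 0, ENNReal.ofReal (l * (Real.exp ((0 - l) * s) * failBound α γ s)) ≤
      ENNReal.ofReal q := by
    refine (lintegral_failBound_le hα hl hγ (by positivity)).trans_eq ?_
    rw [theta_zero hl, hq, zero_sub, sub_zero]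
  refine ⟨(c * max θ 0) ^ (1 - ε) * q ^ ε, by positivity, ?_, ?_⟩
  · have hb : c * max θ 0 < q ^ (-ε / (1 - ε)) := by
      rcases max_choice θ 0 with h' | h'
      · rw [h']; exact h.bound
      · rw [h', mul_zero]; positivity
    calc (c * max θ 0) ^ (1 - ε) * q ^ ε < (q ^ (-ε / (1 - ε))) ^ (1 - ε) * q ^ ε := by
          gcongr
      _ = 1 := by
          rw [← Real.rpow_mul hq0.le, div_mul_cancel₀ _ hp.ne', ← Real.rpow_add hq0]
          simp
  · -- Hölder's inequality with exponents `1 / (1 - ε)` and `1 / ε`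
    have hpt : ∀ s, ENNReal.ofReal (l * c ^ (1 - ε) *
        (Real.exp (((1 - ε) * M - l) * s) * failBound α γ s)) = ENNReal.ofReal (c ^ (1 - ε)) *
          (ENNReal.ofReal (l * (Real.exp ((M - l) * s) * failBound α γ s)) ^ (1 - ε) *
          ENNReal.ofReal (l * (Real.exp ((0 - l) * s) * failBound α γ s)) ^ ε) := by
      intro s
      have hf := hfb s
      rw [ENNReal.ofReal_rpow_of_nonneg (by positivity) hp.le,
        ENNReal.ofReal_rpow_of_nonneg (by positivity) hε0.le, ← ENNReal.ofReal_mul (by positivity),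
        ← ENNReal.ofReal_mul (by positivity), Real.mul_rpow hl.le (by positivity),
        Real.mul_rpow hl.le (by positivity), Real.mul_rpow (by positivity) hf,
        Real.mul_rpow (by positivity) hf, ← Real.exp_mul, ← Real.exp_mul]
      congr 1
      have e1 : l ^ (1 - ε) * l ^ ε = l := by rw [← Real.rpow_add hl]; simp
      have e2 : failBound α γ s ^ (1 - ε) * failBound α γ s ^ ε = failBound α γ s := by
        rw [← Real.rpow_add' hf (by simp)]; simp
      have e3 : Real.exp ((M - l) * s * (1 - ε)) * Real.exp ((0 - l) * s * ε) =
          Real.exp (((1 - ε) * M - l) * s) := by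
        rw [← Real.exp_add]; ring_nf
      calc _ = c ^ (1 - ε) * ((l ^ (1 - ε) * l ^ ε) *
              ((Real.exp ((M - l) * s * (1 - ε)) * Real.exp ((0 - l) * s * ε)) *
              (failBound α γ s ^ (1 - ε) * failBound α γ s ^ ε))) := by rw [e1, e2, e3]; ring
        _ = _ := by ring
    simp_rw [hpt]
    rw [lintegral_const_mul _ (by fun_prop)]
    have hH := ENNReal.lintegral_mul_norm_pow_le (μ := volume.restrict (Ioi (0 : ℝ)))
      (f := fun s => ENNReal.ofReal (l * (Real.exp ((M - l) * s) * failBound α γ s)))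
      (g := fun s => ENNReal.ofReal (l * (Real.exp ((0 - l) * s) * failBound α γ s)))
      (by fun_prop) (by fun_prop) hp.le hε0.le (by ring)
    refine (mul_le_mul' le_rfl (hH.trans (mul_le_mul' (ENNReal.rpow_le_rpow hI1 hp.le)
      (ENNReal.rpow_le_rpow hI0 hε0.le)))).trans_eq ?_
    rw [ENNReal.ofReal_rpow_of_nonneg (by positivity) hp.le,
      ENNReal.ofReal_rpow_of_nonneg (by positivity) hε0.le, ← ENNReal.ofReal_mul (by positivity),
      ← ENNReal.ofReal_mul (by positivity), Real.mul_rpow (by linarith) (by positivity), mul_assoc]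

/-- As `c` decreases to one, `m(c)` tends to zero and `c θ(m(c))` to one. -/
theorem exists_admissible {l m α γ ε : ℝ} (hα : 1 < α) (hl : 0 < l) (hlm : l < m) (hγ : 0 < γ)
    (hε : ε ∈ Ioo (0 : ℝ) 1) : ∃ c, Admissible l m α γ ε c := by
  obtain ⟨hq0, hq1⟩ := failProb_mem_Ioo hα hl hγ
  set q := 1 - α ^ (-l / γ) * (γ / (l + γ)) with hq
  have hα0 : 0 < α := by linarith
  have hm : Tendsto (mFun l m) (𝓝 1) (𝓝 0) := by
    have hc : ContinuousAt (mFun l m) 1 := by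
      unfold mFun
      exact ((continuousAt_const.mul continuousAt_id).sub
        (continuousAt_const.mul (continuousAt_inv₀ one_ne_zero))).add continuousAt_const
    have h1 : mFun l m 1 = 0 := by simp [mFun]
    rw [← h1]
    exact hc
  have hθ : ContinuousAt (theta α l γ) 0 := by
    have he : theta α l γ =ᶠ[𝓝 0] fun a =>
        a * γ / ((a - l) * (l + γ - a)) * α ^ ((a - l) / γ) + l / (l - a) := by
      filter_upwards [eventually_ne_nhds hl.ne] with a ha
      simp [theta, ha]
    refine ContinuousAt.congr ?_ he.symm
    have h1 : ((0 : ℝ) - l) * (l + γ - 0) ≠ 0 := by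
      rw [zero_sub, sub_zero]; exact mul_ne_zero (by linarith) (by linarith)
    have h2 : l - (0 : ℝ) ≠ 0 := by simpa using hl.ne'
    have h3 : ContinuousAt (fun a : ℝ => α ^ ((a - l) / γ)) 0 :=
      ContinuousAt.rpow continuousAt_const (by fun_prop) (Or.inl hα0.ne')
    have h4 : ContinuousAt (fun a : ℝ => a * γ / ((a - l) * (l + γ - a))) 0 :=
      ContinuousAt.div (by fun_prop) (by fun_prop) h1
    have h5 : ContinuousAt (fun a : ℝ => l / (l - a)) 0 :=
      ContinuousAt.div (by fun_prop) (by fun_prop) h2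
    exact (h4.mul h3).add h5
  have hlim : Tendsto (fun c => c * theta α l γ (mFun l m c)) (𝓝 1) (𝓝 1) := by
    have h0 : Tendsto (theta α l γ) (𝓝 0) (𝓝 1) := by
      have := hθ.tendsto
      rwa [theta_zero hl] at this
    simpa using tendsto_id.mul (h0.comp hm)
  have hbig : 1 < q ^ (-ε / (1 - ε)) :=
    Real.one_lt_rpow_of_pos_of_lt_one_of_neg hq0 hq1
      (div_neg_of_neg_of_pos (by linarith [hε.1]) (by linarith [hε.2]))
  have hstar : 1 < cStar l m :=
    Real.one_lt_rpow_of_pos_of_lt_one_of_neg (div_pos hl (hl.trans hlm))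
      ((div_lt_one (hl.trans hlm)).2 hlm) (by norm_num)
  have hev : ∀ᶠ c in 𝓝[>] (1 : ℝ), Admissible l m α γ ε c := by
    filter_upwards [self_mem_nhdsWithin, nhdsWithin_le_nhds (eventually_lt_nhds hstar),
      nhdsWithin_le_nhds (hm.eventually_lt_const (by positivity : (0 : ℝ) < l + γ)),
      nhdsWithin_le_nhds (hlim.eventually_lt_const hbig)] with c h1 h2 h3 h4
    exact ⟨hε, ⟨h1, h2⟩, h3, h4⟩
  exact hev.exists

end Parameters

/-! ### Comparison of the renewal equation at two states -/

section Oscillation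

/-- Averaging over probability measures carried by a set `A` preserves bounds for the oscillation
on `A`. -/
theorem semi_le_semi_add {S : Type*} {G : S → S → ℝ} {t : ℝ} {A : Set S}
    (hone : ∀ x ∈ A, semi G t (fun _ => 1) x = 1)
    (hA : ∀ x ∈ A, ∀ w ∉ A, transKer G x w t = 0) {g : S → ℝ≥0∞} {o : ℝ≥0∞}
    (hg : ∀ w ∈ A, ∀ w' ∈ A, g w ≤ g w' + o) {x y : S} (hx : x ∈ A) (hy : y ∈ A) :
    semi G t g x ≤ semi G t g y + o := by
  have hbound : ∀ (f f' : S → ℝ≥0∞), ∀ x ∈ A, (∀ w ∈ A, f w ≤ f' w) →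
      semi G t f x ≤ semi G t f' x := by
    intro f f' x hx h
    refine ENNReal.tsum_le_tsum fun w => ?_
    by_cases hw : w ∈ A
    · exact mul_le_mul' le_rfl (h w hw)
    · simp [hA x hx w hw]
  have h1 : ∀ w ∈ A, g w ≤ semi G t g y + o := by
    intro w hw
    calc g w = semi G t (fun _ => g w) y := by rw [semi_const, hone y hy, one_mul]
      _ ≤ semi G t (fun w' => g w' + o) y := hbound _ _ y hy fun w' hw' => hg w hw w' hw'
      _ = semi G t g y + o := by
          rw [semi_add G t g (fun _ => o), semi_const G t o, hone y hy, one_mul]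
  calc semi G t g x ≤ semi G t (fun _ => semi G t g y + o) x := hbound _ _ x hx h1
    _ = _ := by rw [semi_const, hone x hx, one_mul]

theorem semi_levelGen_le {D : Type*} {down : D → ℝ} {env : ℕ → D → D → ℝ}
    (hone : ∀ t : ℝ, 0 ≤ t → ∀ x, semi (levelGen 0 down env) t (fun _ => 1) x = 1) {t : ℝ}
    (ht : 0 ≤ t) {n : ℕ} {g : ℕ × D → ℝ≥0∞} {o : ℝ≥0∞}
    (hg : ∀ w w', w.1 ≤ n → w'.1 ≤ n → g w ≤ g w' + o) {x y : ℕ × D} (hx : x.1 ≤ n)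
    (hy : y.1 ≤ n) :
    semi (levelGen 0 down env) t g x ≤ semi (levelGen 0 down env) t g y + o := by
  refine semi_le_semi_add (A := {w : ℕ × D | w.1 ≤ n}) (fun x _ => hone t ht x) (fun x hx w hw => ?_)
    (fun w hw w' hw' => hg w w' hw hw') hx hy
  rw [transKer_of_nonneg _ _ _ ht]
  exact trans_levelGen_eq_zero _ _ _ (lt_of_le_of_lt hx (not_le.1 hw))

/-- Comparison of the renewal equation at two states. -/
theorem renewal_le_renewal_add {S : Type*} [Countable S] {Q G : S → S → ℝ} {J : S → S → ℝ≥0∞}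
    {r t : ℝ} {f : S → ℝ≥0∞} {x y : S} {δ : ℝ≥0∞} {o : ℝ → ℝ≥0∞}
    (h0 : semi G t f x ≤ semi G t f y + δ)
    (h : ∀ s ∈ Icc 0 t, semi G s (fun w => ∑' w', J w w' * semi Q (t - s) f w') x ≤
      semi G s (fun w => ∑' w', J w w' * semi Q (t - s) f w') y + o s) :
    renewal Q G J r t f x ≤ renewal Q G J r t f y +
      (ENNReal.ofReal (Real.exp (-r * t)) * δ +
        ∫⁻ s in Icc 0 t, ENNReal.ofReal (Real.exp (-r * s)) * o s) := by
  unfold renewal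
  rw [add_add_add_comm, ← mul_add, ← lintegral_add_left
    (measurable_renewal_integrand Q G J r t f y)]
  refine add_le_add (mul_le_mul' le_rfl h0) (setLIntegral_mono' measurableSet_Icc fun s hs => ?_)
  rw [← mul_add]
  exact mul_le_mul' le_rfl (h s hs)

/-- The oscillation bound `o` is preserved, with total mass `L`, by the arrivals and fictitious
arrivals of two queues: although their rates differ, each average lies between the minimum and the
maximum of its two values. -/
theorem uniform_arrival_le {l l' L : ℝ} (hl : 0 ≤ l) (hlL : l ≤ L) (hl' : 0 ≤ l') (hlL' : l' ≤ L)
    {a b a' b' o : ℝ≥0∞} (haa : a ≤ a' + o) (hab : a ≤ b' + o) (hba : b ≤ a' + o)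
    (hbb : b ≤ b' + o) :
    ENNReal.ofReal l * a + ENNReal.ofReal (L - l) * b ≤
      ENNReal.ofReal l' * a' + ENNReal.ofReal (L - l') * b' + ENNReal.ofReal L * o := by
  have hsplit : ∀ {l : ℝ}, 0 ≤ l → l ≤ L → ∀ c, ENNReal.ofReal L * c =
      ENNReal.ofReal l * c + ENNReal.ofReal (L - l) * c := fun h0 h1 c => by
    rw [← add_mul, ← ENNReal.ofReal_add h0 (sub_nonneg.2 h1), add_sub_cancel]
  calc _ ≤ ENNReal.ofReal l * max a b + ENNReal.ofReal (L - l) * max a b := by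
        gcongr
        · exact le_max_left _ _
        · exact le_max_right _ _
    _ = ENNReal.ofReal l' * max a b + ENNReal.ofReal (L - l') * max a b := by
        rw [← hsplit hl hlL, hsplit hl' hlL']
    _ ≤ ENNReal.ofReal l' * (a' + o) + ENNReal.ofReal (L - l') * (b' + o) := by
        gcongr
        · exact max_le haa hba
        · exact max_le hab hbb
    _ = _ := by
        rw [hsplit hl' hlL' o]; ring

variable {D : Type u} {T : ℕ → D → D → ℝ} {v lam mu : D → ℝ} {l m : ℝ}

/-- The standing assumptions on the queue and its environment. -/
structure QueueAssumptions (T : ℕ → D → D → ℝ) (v lam mu : D → ℝ) (l m : ℝ) : Prop where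
  gen : ∀ n, IsChainGenerator (T n)
  irr : IsIrreducible (T 0)
  inv : IsCommonInvariant T v
  summable : Summable v
  lam_pos : ∀ z, 0 < lam z
  l_pos : 0 < l
  l_lt_m : l < m
  lam_le : ∀ z, lam z ≤ l
  le_mu : ∀ z, m ≤ mu z

namespace QueueAssumptions

theorem m_pos (h : QueueAssumptions T v lam mu l m) : 0 < m := h.l_pos.trans h.l_lt_m

theorem mu_pos (h : QueueAssumptions T v lam mu l m) (z : D) : 0 < mu z :=
  h.m_pos.trans_le (h.le_mu z)

theorem rho_pos (h : QueueAssumptions T v lam mu l m) (z : D) : 0 < lam z / mu z :=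
  div_pos (h.lam_pos z) (h.mu_pos z)

theorem rho_le (h : QueueAssumptions T v lam mu l m) (z : D) : lam z / mu z ≤ l / m :=
  div_le_div₀ h.l_pos.le (h.lam_le z) h.m_pos (h.le_mu z)

theorem rho_lt_one (h : QueueAssumptions T v lam mu l m) (z : D) : lam z / mu z < 1 :=
  (h.rho_le z).trans_lt ((div_lt_one h.m_pos).2 h.l_lt_m)

theorem isSplitting (h : QueueAssumptions T v lam mu l m) {θ : ℝ} (hθ0 : 0 ≤ θ) (hθ : θ ≤ m) :
    IsSplitting (queueGen lam mu T) (levelGen 0 (fun z => mu z - θ) (queueEnv lam mu T))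
      (uniformJump lam l θ) (l + θ) (fun x => l - lam x.2 + if x.1 = 0 then θ else 0) :=
  isSplitting_levelGen (queueEnv lam mu T) (fun z => (h.lam_pos z).le) h.l_pos.le h.lam_le hθ0
    fun z => hθ.trans (h.le_mu z)

theorem isConservative (h : QueueAssumptions T v lam mu l m) :
    IsConservative (queueGen lam mu T) :=
  isConservative_levelGen (fun z => (h.lam_pos z).le) (fun z => (h.mu_pos z).le)
    (isConservative_queueEnv (fun z => (h.rho_pos z).le)
      fun n => (h.gen n).toIsRateMatrix.isConservative)

variable [Countable D]

theorem semi_death_one (h : QueueAssumptions T v lam mu l m) {θ : ℝ} (hθ : θ ≤ m) {t : ℝ}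
    (ht : 0 ≤ t) (x : ℕ × D) :
    semi (levelGen 0 (fun z => mu z - θ) (queueEnv lam mu T)) t (fun _ => 1) x = 1 :=
  semi_levelGen_queueEnv_one h.gen h.irr h.inv h.summable h.rho_pos (fun z => (h.rho_lt_one z).le)
    (fun z => sub_nonneg.2 (hθ.trans (h.le_mu z))) ht x

theorem semi_queue_one (h : QueueAssumptions T v lam mu l m) {t : ℝ} (ht : 0 ≤ t) (x : ℕ × D) :
    semi (queueGen lam mu T) t (fun _ => 1) x = 1 :=
  (h.isSplitting le_rfl h.m_pos.le).semi_one h.isConservative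
    (fun _ hs => h.semi_death_one h.m_pos.le hs) ht x

theorem semi_eq_renewal (h : QueueAssumptions T v lam mu l m) {θ : ℝ} (hθ0 : 0 ≤ θ) (hθ : θ ≤ m)
    {t : ℝ} (ht : 0 ≤ t) {f : ℕ × D → ℝ≥0∞} (hf : ∀ y, f y ≤ 1) (x : ℕ × D) :
    semi (queueGen lam mu T) t f x =
      renewal (queueGen lam mu T) (levelGen 0 (fun z => mu z - θ) (queueEnv lam mu T))
        (uniformJump lam l θ) (l + θ) t f x :=
  (h.isSplitting hθ0 hθ).semi_eq_renewal (fun _ hs => h.semi_queue_one hs)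
    (fun _ hs => h.semi_death_one hθ hs x) ht hf

end QueueAssumptions

end Oscillation

/-! ### Decay of the oscillation -/

section Decay

variable {D : Type u} {T : ℕ → D → D → ℝ} {v lam mu : D → ℝ} {l m : ℝ}

theorem HasExpCoupling.semi_le_failBound [Countable D] [MeasurableSpace D]
    [DiscreteMeasurableSpace D] {Q : D → D → ℝ} {α γ : ℝ}
    (h : HasExpCoupling.{u, w} Q α γ) (hQ : IsChainGenerator Q) {t : ℝ} (ht : 0 ≤ t)
    {g : D → ℝ≥0∞} {o : ℝ≥0∞} (hg : ∀ z z', g z ≤ g z' + o) (z₁ z₂ : D) :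
    semi Q t g z₁ ≤ semi Q t g z₂ + ENNReal.ofReal (failBound α γ t) * o := by
  rcases min_choice 1 (α * Real.exp (-γ * t)) with h' | h'
  · rw [failBound, h', ENNReal.ofReal_one, one_mul]
    exact semi_le_semi_add (A := univ) (fun x _ => by rw [semi_one _ ht, hQ.nonexplosive t ht])
      (fun x _ w hw => absurd (mem_univ w) hw) (fun w _ w' _ => hg w w') (mem_univ _) (mem_univ _)
  · rw [failBound, h']
    exact h.semi_le ht hg z₁ z₂

theorem queueEnv_zero (lam mu : D → ℝ) (T : ℕ → D → D → ℝ) : queueEnv lam mu T 0 = T 0 := by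
  funext z z'
  simp [queueEnv]

variable [Countable D]

/-- One step of the comparison for states at levels up to `n + 1`. Both chains are followed up to
the next ring of a common clock of rate `l + m`; the bound for their levels then becomes `n + 2` at
rate `l` and `n` at rate `m`. -/
theorem QueueAssumptions.osc_step_succ (h : QueueAssumptions T v lam mu l m) {a b K c t : ℝ}
    (hb : 1 ≤ b) (hdrift : l * b + m * b⁻¹ ≤ l + m - a) (hK : 1 ≤ K) (hc : 0 ≤ c) (ht : 0 ≤ t)
    {f : ℕ × D → ℝ≥0∞} (hf : ∀ y, f y ≤ 1) {n : ℕ}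
    (ih : ∀ s, 0 ≤ s → s ≤ t → ∀ n (x y : ℕ × D), x.1 ≤ n → y.1 ≤ n →
      semi (queueGen lam mu T) s f x ≤ semi (queueGen lam mu T) s f y +
        ENNReal.ofReal (K * b ^ n * Real.exp (-a * s) + c))
    {x y : ℕ × D} (hx : x.1 ≤ n + 1) (hy : y.1 ≤ n + 1) :
    semi (queueGen lam mu T) t f x ≤ semi (queueGen lam mu T) t f y +
      ENNReal.ofReal (K * b ^ (n + 1) * Real.exp (-a * t) +
        c * (1 - Real.exp (-(l + m) * t))) := by
  have hl := h.l_pos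
  have hm := h.m_pos
  have hb0 : 0 < b := by linarith
  have hr : 0 < l + m - a := lt_of_lt_of_le (by positivity) hdrift
  set U := fun s => semi (queueGen lam mu T) s f with hU
  -- the oscillation after the ring, at time `s`
  set o : ℝ → ℝ := fun s =>
    K * b ^ (n + 1) * (l + m - a) * Real.exp (-a * (t - s)) + (l + m) * c with ho
  have hone : ∀ t : ℝ, 0 ≤ t → ∀ x,
      semi (levelGen 0 (fun z => mu z - m) (queueEnv lam mu T)) t (fun _ => 1) x = 1 :=
    fun t ht x => h.semi_death_one le_rfl ht x
  have hosc : ∀ s ∈ Icc 0 t, ∀ w w' : ℕ × D, w.1 ≤ n + 1 → w'.1 ≤ n + 1 →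
      ∑' w₁, uniformJump lam l m w w₁ * U (t - s) w₁ ≤
        ∑' w₁, uniformJump lam l m w' w₁ * U (t - s) w₁ + ENNReal.ofReal (o s) := by
    rintro s hs ⟨i, z⟩ ⟨i', z'⟩ hi hi'
    simp only at hi hi'
    have ih' := ih (t - s) (by linarith [hs.2]) (by linarith [hs.1])
    rw [tsum_uniformJump_mul, tsum_uniformJump_mul, ← add_assoc, ← add_assoc]
    have h1 := uniform_arrival_le (h.lam_pos z).le (h.lam_le z) (h.lam_pos z').le (h.lam_le z')
      (ih' (n + 2) (i + 1, z) (i' + 1, z') (by simpa using hi) (by simpa using hi'))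
      (ih' (n + 2) (i + 1, z) (i', z') (by simpa using hi) (by simp only; omega))
      (ih' (n + 2) (i, z) (i' + 1, z') (by simp only; omega) (by simpa using hi'))
      (ih' (n + 2) (i, z) (i', z') (by simp only; omega) (by simp only; omega))
    have h2 := ih' n (i - 1, z) (i' - 1, z') (by simp only; omega) (by simp only; omega)
    refine (add_le_add h1 (mul_le_mul' le_rfl h2)).trans ?_
    rw [mul_add, add_add_add_comm, ← ENNReal.ofReal_mul hl.le, ← ENNReal.ofReal_mul hm.le,
      ← ENNReal.ofReal_add (by positivity) (by positivity)]
    refine add_le_add le_rfl (ENNReal.ofReal_le_ofReal ?_)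
    have e : l * (K * b ^ (n + 2) * Real.exp (-a * (t - s)) + c) +
        m * (K * b ^ n * Real.exp (-a * (t - s)) + c) =
        K * b ^ (n + 1) * (l * b + m * b⁻¹) * Real.exp (-a * (t - s)) + (l + m) * c := by
      field_simp
      ring
    rw [e]
    have : K * b ^ (n + 1) * (l * b + m * b⁻¹) ≤ K * b ^ (n + 1) * (l + m - a) :=
      mul_le_mul_of_nonneg_left hdrift (by positivity)
    have := mul_le_mul_of_nonneg_right this (Real.exp_nonneg (-a * (t - s)))
    simp only [ho]
    linarith
  rw [h.semi_eq_renewal hm.le le_rfl ht hf x, h.semi_eq_renewal hm.le le_rfl ht hf y]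
  refine (renewal_le_renewal_add (δ := 1) (o := fun s => ENNReal.ofReal (o s)) ?_
    fun s hs => semi_levelGen_le hone hs.1 (hosc s hs) hx hy).trans ?_
  · exact semi_levelGen_le hone ht (fun w w' _ _ => (hf w).trans le_add_self) hx hy
  · refine add_le_add le_rfl ?_
    have hd : ∀ s, HasDerivAt (fun s => -(K * b ^ (n + 1) * Real.exp (-a * t) *
        Real.exp (-(l + m - a) * s)) - c * Real.exp (-(l + m) * s))
        (Real.exp (-(l + m) * s) * o s) s := by
      intro s
      have d1 := (((hasDerivAt_id' s).const_mul (-(l + m - a))).exp).const_mul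
        (K * b ^ (n + 1) * Real.exp (-a * t))
      have d2 := (((hasDerivAt_id' s).const_mul (-(l + m))).exp).const_mul c
      refine (d1.neg.sub d2).congr_deriv ?_
      have e : Real.exp (-(l + m) * s) * Real.exp (-a * (t - s)) =
          Real.exp (-a * t) * Real.exp (-(l + m - a) * s) := by
        rw [← Real.exp_add, ← Real.exp_add]; ring_nf
      simp only [ho]
      linear_combination (-(K * b ^ (n + 1) * (l + m - a))) * e
    have ho0 : ∀ s, 0 ≤ o s := fun s => by simp only [ho]; positivity
    have hI := setLIntegral_ofReal_Icc ht hd (by simp only [ho]; fun_prop)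
      fun s _ => mul_nonneg (Real.exp_nonneg _) (ho0 s)
    simp_rw [← ENNReal.ofReal_mul (Real.exp_nonneg _)]
    rw [hI, mul_one, ← ENNReal.ofReal_add (by positivity)]
    · refine ENNReal.ofReal_le_ofReal ?_
      have e : Real.exp (-a * t) * Real.exp (-(l + m - a) * t) = Real.exp (-(l + m) * t) := by
        rw [← Real.exp_add]; ring_nf
      have hKb : 1 ≤ K * b ^ (n + 1) := one_le_mul_of_one_le_of_one_le hK (one_le_pow₀ hb)
      have := mul_le_mul_of_nonneg_right hKb (Real.exp_nonneg (-(l + m) * t))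
      simp only [mul_zero, Real.exp_zero, mul_one]
      rw [mul_assoc (K * b ^ (n + 1)) (Real.exp (-a * t)), e]
      linarith
    · have e1 : Real.exp (-(l + m - a) * t) ≤ 1 := Real.exp_le_one_iff.2 (by nlinarith)
      have e2 : Real.exp (-(l + m) * t) ≤ 1 := Real.exp_le_one_iff.2 (by nlinarith)
      have := mul_le_mul_of_nonneg_left e1
        (by positivity : 0 ≤ K * b ^ (n + 1) * Real.exp (-a * t))
      have := mul_le_mul_of_nonneg_left e2 hc
      simp only [mul_zero, Real.exp_zero, mul_one]
      linarith

variable [MeasurableSpace D] [DiscreteMeasurableSpace D]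

/-- One step of the comparison for two states with empty queue: the environments are coupled, and
a common clock of rate `l` rings at the next possible arrival. -/
theorem QueueAssumptions.osc_step_zero (h : QueueAssumptions T v lam mu l m) {a b K c t α γ κ : ℝ}
    (hb : 1 ≤ b) (hα : 1 < α) (hcoup : HasExpCoupling.{u, w} (T 0) α γ)
    (haγ : a ≤ l + γ) (hκ0 : 0 ≤ κ) (hκ1 : κ < 1)
    (hκ : ∫⁻ s in Ioi 0, ENNReal.ofReal (l * b * (Real.exp ((a - l) * s) * failBound α γ s)) ≤
      ENNReal.ofReal κ)
    (hK : α ≤ K * (1 - κ)) (hc : 0 ≤ c) (ht : 0 ≤ t)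
    {f : ℕ × D → ℝ≥0∞} (hf : ∀ y, f y ≤ 1)
    (ih : ∀ s, 0 ≤ s → s ≤ t → ∀ n (x y : ℕ × D), x.1 ≤ n → y.1 ≤ n →
      semi (queueGen lam mu T) s f x ≤ semi (queueGen lam mu T) s f y +
        ENNReal.ofReal (K * b ^ n * Real.exp (-a * s) + c)) (z₁ z₂ : D) :
    semi (queueGen lam mu T) t f (0, z₁) ≤ semi (queueGen lam mu T) t f (0, z₂) +
      ENNReal.ofReal (K * Real.exp (-a * t) + c * (1 - Real.exp (-l * t))) := by
  have hl := h.l_pos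
  have hb0 : 0 < b := by linarith
  have hK0 : 0 < K := by
    by_contra hn
    nlinarith
  have hfb := failBound_nonneg (by linarith : 0 ≤ α) γ
  set U := fun s => semi (queueGen lam mu T) s f with hU
  set o : ℝ → ℝ := fun s => failBound α γ s * (l * (K * b * Real.exp (-a * (t - s)) + c)) with ho
  have hzero : ∀ s, 0 ≤ s → ∀ (g : ℕ × D → ℝ≥0∞) (δ : ℝ≥0∞),
      (∀ z z', g (0, z) ≤ g (0, z') + δ) →
      semi (levelGen 0 (fun z => mu z - 0) (queueEnv lam mu T)) s g (0, z₁) ≤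
        semi (levelGen 0 (fun z => mu z - 0) (queueEnv lam mu T)) s g (0, z₂) +
          ENNReal.ofReal (failBound α γ s) * δ := by
    intro s hs g δ hg
    rw [semi_levelGen_zero, semi_levelGen_zero, queueEnv_zero]
    exact hcoup.semi_le_failBound (h.gen 0) hs hg z₁ z₂
  have hosc : ∀ s ∈ Icc 0 t, ∀ z z' : D,
      ∑' w₁, uniformJump lam l 0 (0, z) w₁ * U (t - s) w₁ ≤
        ∑' w₁, uniformJump lam l 0 (0, z') w₁ * U (t - s) w₁ +
          ENNReal.ofReal (l * (K * b * Real.exp (-a * (t - s)) + c)) := by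
    intro s hs z z'
    have ih' := fun x y => ih (t - s) (by linarith [hs.2]) (by linarith [hs.1]) 1 x y
    rw [tsum_uniformJump_mul, tsum_uniformJump_mul, ENNReal.ofReal_zero, zero_mul, add_zero,
      zero_mul, add_zero, ENNReal.ofReal_mul hl.le]
    rw [pow_one] at ih'
    exact uniform_arrival_le (h.lam_pos z).le (h.lam_le z) (h.lam_pos z').le (h.lam_le z')
      (ih' _ _ le_rfl le_rfl) (ih' _ _ le_rfl zero_le_one) (ih' _ _ zero_le_one le_rfl)
      (ih' _ _ zero_le_one zero_le_one)
  rw [h.semi_eq_renewal le_rfl h.m_pos.le ht hf (0, z₁),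
    h.semi_eq_renewal le_rfl h.m_pos.le ht hf (0, z₂), add_zero]
  refine (renewal_le_renewal_add (δ := ENNReal.ofReal (failBound α γ t))
    (o := fun s => ENNReal.ofReal (o s)) ?_ fun s hs => ?_).trans (add_le_add le_rfl ?_)
  · simpa using hzero t ht f 1 fun z z' => (hf _).trans le_add_self
  · rw [ho, ENNReal.ofReal_mul (hfb s)]
    exact hzero s hs.1 _ _ (hosc s hs)
  · have hpt : ∀ s, ENNReal.ofReal (Real.exp (-l * s)) * ENNReal.ofReal (o s) ≤
        ENNReal.ofReal (K * Real.exp (-a * t)) *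
          ENNReal.ofReal (l * b * (Real.exp ((a - l) * s) * failBound α γ s)) +
        ENNReal.ofReal c * (ENNReal.ofReal l * ENNReal.ofReal (Real.exp (-l * s))) := by
      intro s
      have := hfb s
      rw [← ENNReal.ofReal_mul (by positivity), ← ENNReal.ofReal_mul (by positivity),
        ← ENNReal.ofReal_mul hl.le, ← ENNReal.ofReal_mul hc,
        ← ENNReal.ofReal_add (by positivity) (by positivity)]
      refine ENNReal.ofReal_le_ofReal ?_
      have e : Real.exp (-l * s) * Real.exp (-a * (t - s)) =
          Real.exp (-a * t) * Real.exp ((a - l) * s) := by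
        rw [← Real.exp_add, ← Real.exp_add]; ring_nf
      have h1 : c * (l * Real.exp (-l * s)) * failBound α γ s ≤ c * (l * Real.exp (-l * s)) :=
        mul_le_of_le_one_right (by positivity) (failBound_le_one _ _ _)
      calc Real.exp (-l * s) * o s
          = failBound α γ s * l * K * b * (Real.exp (-l * s) * Real.exp (-a * (t - s))) +
              c * (l * Real.exp (-l * s)) * failBound α γ s := by simp only [ho]; ring
        _ ≤ failBound α γ s * l * K * b * (Real.exp (-a * t) * Real.exp ((a - l) * s)) +
              c * (l * Real.exp (-l * s)) := by rw [e]; linarith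
        _ = _ := by ring
    have hsub : ∫⁻ s in Icc 0 t,
        ENNReal.ofReal (l * b * (Real.exp ((a - l) * s) * failBound α γ s)) ≤
          ENNReal.ofReal κ := by
      refine le_trans ?_ hκ
      rw [setLIntegral_congr Ioi_ae_eq_Ici]
      exact lintegral_mono_set fun s hs => hs.1
    have hint : ∫⁻ s in Icc 0 t, ENNReal.ofReal (Real.exp (-l * s)) * ENNReal.ofReal (o s) ≤
        ENNReal.ofReal (K * Real.exp (-a * t)) * ENNReal.ofReal κ +
          ENNReal.ofReal c * ENNReal.ofReal (1 - Real.exp (-l * t)) := by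
      refine (lintegral_mono hpt).trans ?_
      rw [lintegral_add_left (by fun_prop), lintegral_const_mul _ (by fun_prop),
        lintegral_const_mul _ (by fun_prop), lintegral_const_mul _ (by fun_prop),
        ofReal_mul_setLIntegral_exp hl.le ht]
      exact add_le_add (mul_le_mul' le_rfl hsub) le_rfl
    refine (add_le_add le_rfl hint).trans ?_
    have e1 : Real.exp (-l * t) ≤ 1 := Real.exp_le_one_iff.2 (by nlinarith)
    have hf0 := hfb t
    rw [← ENNReal.ofReal_mul (by positivity), ← ENNReal.ofReal_mul (by positivity),
      ← ENNReal.ofReal_mul hc, ← ENNReal.ofReal_add (by positivity)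
      (mul_nonneg hc (sub_nonneg.2 e1)), ← ENNReal.ofReal_add (by positivity)
      (add_nonneg (by positivity) (mul_nonneg hc (sub_nonneg.2 e1)))]
    refine ENNReal.ofReal_le_ofReal ?_
    have h2 : Real.exp (-l * t) * failBound α γ t ≤ α * Real.exp (-a * t) := by
      calc _ ≤ Real.exp (-l * t) * (α * Real.exp (-γ * t)) :=
            mul_le_mul_of_nonneg_left (min_le_right _ _) (Real.exp_nonneg _)
        _ = α * Real.exp (-(l + γ) * t) := by
            rw [mul_left_comm, ← Real.exp_add]; ring_nf
        _ ≤ _ := by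
            refine mul_le_mul_of_nonneg_left (Real.exp_le_exp.2 ?_) (by linarith)
            nlinarith
    have h3 := mul_le_mul_of_nonneg_right hK (Real.exp_nonneg (-a * t))
    linarith

/-- The oscillation of `P^t f` over the levels up to `n` decays like `b^n e^{-at}`. -/
theorem QueueAssumptions.osc_le (h : QueueAssumptions T v lam mu l m) {a b K α γ κ : ℝ}
    (hb : 1 ≤ b) (hdrift : l * b + m * b⁻¹ ≤ l + m - a) (hα : 1 < α)
    (hcoup : HasExpCoupling.{u, w} (T 0) α γ) (haγ : a ≤ l + γ) (hκ0 : 0 ≤ κ) (hκ1 : κ < 1)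
    (hκ : ∫⁻ s in Ioi 0, ENNReal.ofReal (l * b * (Real.exp ((a - l) * s) * failBound α γ s)) ≤
      ENNReal.ofReal κ)
    (hK : α ≤ K * (1 - κ)) {t : ℝ} (ht : 0 ≤ t) {f : ℕ × D → ℝ≥0∞} (hf : ∀ y, f y ≤ 1) {n : ℕ}
    {x y : ℕ × D} (hx : x.1 ≤ n) (hy : y.1 ≤ n) :
    semi (queueGen lam mu T) t f x ≤ semi (queueGen lam mu T) t f y +
      ENNReal.ofReal (K * b ^ n * Real.exp (-a * t)) := by
  have hl := h.l_pos
  have hm := h.m_pos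
  have hb0 : 0 < b := by linarith
  have hK1 : 1 ≤ K := by
    by_contra hn
    nlinarith
  -- an error that is constant in time contracts by the factor `q` at each application of the
  -- renewal equation, as long as the time stays below `t`
  set q := 1 - Real.exp (-(l + m) * t) with hq
  have hq0 : 0 ≤ q := sub_nonneg.2 (Real.exp_le_one_iff.2 (by nlinarith))
  have hq1 : q < 1 := by rw [hq]; linarith [Real.exp_pos (-(l + m) * t)]
  have key : ∀ k : ℕ, ∀ s, 0 ≤ s → s ≤ t → ∀ n (x y : ℕ × D), x.1 ≤ n → y.1 ≤ n →
      semi (queueGen lam mu T) s f x ≤ semi (queueGen lam mu T) s f y +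
        ENNReal.ofReal (K * b ^ n * Real.exp (-a * s) + q ^ k) := by
    intro k
    induction k with
    | zero =>
      intro s hs _ n x y _ _
      have h1 : semi (queueGen lam mu T) s f x ≤ 1 :=
        (semi_mono _ _ hf x).trans_eq (h.semi_queue_one hs x)
      refine h1.trans (le_add_left ?_)
      rw [← ENNReal.ofReal_one, pow_zero]
      exact ENNReal.ofReal_le_ofReal (le_add_of_nonneg_left (by positivity))
    | succ k ih =>
      intro s hs hst n x y hx hy
      have ih' := fun s' h0 (h1 : s' ≤ s) => ih s' h0 (h1.trans hst)
      have hqk := pow_nonneg hq0 k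
      rcases n with _ | n
      · obtain ⟨i, z₁⟩ := x
        obtain ⟨i', z₂⟩ := y
        obtain rfl : i = 0 := Nat.le_zero.1 hx
        obtain rfl : i' = 0 := Nat.le_zero.1 hy
        refine (h.osc_step_zero hb hα hcoup haγ hκ0 hκ1 hκ hK hqk hs hf ih' z₁ z₂).trans
          (add_le_add le_rfl (ENNReal.ofReal_le_ofReal ?_))
        rw [pow_zero, mul_one, pow_succ]
        refine add_le_add le_rfl (mul_le_mul_of_nonneg_left ?_ hqk)
        refine sub_le_sub_left (Real.exp_le_exp.2 ?_) 1
        nlinarith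
      · refine (h.osc_step_succ hb hdrift hK1 hqk hs hf ih' hx hy).trans
          (add_le_add le_rfl (ENNReal.ofReal_le_ofReal ?_))
        rw [pow_succ q]
        refine add_le_add le_rfl (mul_le_mul_of_nonneg_left ?_ hqk)
        refine sub_le_sub_left (Real.exp_le_exp.2 ?_) 1
        nlinarith
  have hlim : Tendsto (fun k : ℕ => semi (queueGen lam mu T) t f y +
      ENNReal.ofReal (K * b ^ n * Real.exp (-a * t) + q ^ k)) atTop
      (𝓝 (semi (queueGen lam mu T) t f y +
        ENNReal.ofReal (K * b ^ n * Real.exp (-a * t) + 0))) :=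
    tendsto_const_nhds.add (ENNReal.tendsto_ofReal
      (tendsto_const_nhds.add (tendsto_pow_atTop_nhds_zero_of_lt_one hq0 hq1)))
  rw [add_zero] at hlim
  exact ge_of_tendsto' hlim fun k => key k t ht le_rfl n x y hx hy

end Decay

/-! ### The stationary distribution -/

section Stationary

variable {D : Type u} {T : ℕ → D → D → ℝ} {v lam mu : D → ℝ} {l m : ℝ}

/-- The weights of the probability measure `π`. -/
noncomputable def piWeight (lam mu v : D → ℝ) (x : ℕ × D) : ℝ≥0∞ :=
  ENNReal.ofReal ((lam x.2 / mu x.2) ^ x.1 * v x.2 / normConst lam mu v)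

theorem QueueAssumptions.normConst_pos (h : QueueAssumptions T v lam mu l m)
    (hΞ : Summable fun z => v z / (1 - lam z / mu z)) : 0 < normConst lam mu v := by
  obtain ⟨z₀, -⟩ := Function.ne_iff.1 h.inv.ne_zero
  have hpos : ∀ z, 0 < v z / (1 - lam z / mu z) := fun z =>
    div_pos (h.inv.pos (fun n => (h.gen n).toIsRateMatrix) h.irr z)
      (sub_pos.2 (h.rho_lt_one z))
  exact hΞ.tsum_pos (fun z => (hpos z).le) z₀ (hpos z₀)

theorem QueueAssumptions.tsum_piWeight_mul_pow (h : QueueAssumptions T v lam mu l m)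
    (hΞ : 0 < normConst lam mu v) {b : ℝ} (hb0 : 0 ≤ b) (hb : ∀ z, lam z / mu z * b < 1) :
    ∑' x : ℕ × D, piWeight lam mu v x * ENNReal.ofReal (b ^ x.1) =
      ∑' z, ENNReal.ofReal (v z / normConst lam mu v * (1 - lam z / mu z * b)⁻¹) := by
  rw [ENNReal.tsum_prod', ENNReal.tsum_comm]
  refine tsum_congr fun z => ?_
  have hρ := (h.rho_pos z).le
  have hv := h.inv.nonneg z
  have hgeo := (hasSum_geometric_of_lt_one (by positivity : 0 ≤ lam z / mu z * b)
    (hb z)).mul_left (v z / normConst lam mu v)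
  rw [← hgeo.tsum_eq, ENNReal.ofReal_tsum_of_nonneg (fun n => by positivity) hgeo.summable]
  refine tsum_congr fun n => ?_
  rw [piWeight, ← ENNReal.ofReal_mul (by positivity)]
  congr 1
  simp only [mul_pow]
  ring

theorem QueueAssumptions.tsum_piWeight (h : QueueAssumptions T v lam mu l m)
    (hΞ : Summable fun z => v z / (1 - lam z / mu z)) :
    ∑' x, piWeight lam mu v x = 1 := by
  have hpos := h.normConst_pos hΞ
  have e := h.tsum_piWeight_mul_pow hpos zero_le_one fun z => by simpa using h.rho_lt_one z
  simp only [one_pow, ENNReal.ofReal_one, mul_one] at e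
  rw [e, ← ENNReal.ofReal_tsum_of_nonneg, ← ENNReal.ofReal_one]
  · congr 1
    calc ∑' z, v z / normConst lam mu v * (1 - lam z / mu z)⁻¹
        = ∑' z, (normConst lam mu v)⁻¹ * (v z / (1 - lam z / mu z)) :=
          tsum_congr fun z => by ring
      _ = 1 := by rw [tsum_mul_left]; exact inv_mul_cancel₀ hpos.ne'
  · exact fun z => mul_nonneg (div_nonneg (h.inv.nonneg z) hpos.le)
      (inv_nonneg.2 (sub_nonneg.2 (h.rho_lt_one z).le))
  · exact (hΞ.mul_left (normConst lam mu v)⁻¹).congr fun z => by ring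

theorem QueueAssumptions.tsum_piWeight_mul_pow_ne_top (h : QueueAssumptions T v lam mu l m)
    (hΞ : 0 < normConst lam mu v) {b : ℝ} (hb0 : 0 ≤ b) (hb : l / m * b < 1) :
    ∑' x : ℕ × D, piWeight lam mu v x * ENNReal.ofReal (b ^ x.1) ≠ ∞ := by
  have hle : ∀ z, lam z / mu z * b ≤ l / m * b := fun z =>
    mul_le_mul_of_nonneg_right (h.rho_le z) hb0
  rw [h.tsum_piWeight_mul_pow hΞ hb0 fun z => (hle z).trans_lt hb]
  refine ne_top_of_le_ne_top
    ((h.summable.div_const (normConst lam mu v)).mul_right (1 - l / m * b)⁻¹).tsum_ofReal_ne_top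
    (ENNReal.tsum_le_tsum fun z => ENNReal.ofReal_le_ofReal ?_)
  refine mul_le_mul_of_nonneg_left ?_ (div_nonneg (h.inv.nonneg z) hΞ.le)
  exact inv_anti₀ (by linarith) (by linarith [hle z])

/-- The weights of `π` satisfy the balance equations of the queue. Arrivals and services balance
within each state of the environment, and the moves of the environment within each level. -/
theorem QueueAssumptions.balance (h : QueueAssumptions T v lam mu l m)
    (hΞ : 0 < normConst lam mu v) (y : ℕ × D) :
    ∑' x, piWeight lam mu v x * jumpRate (queueGen lam mu T) x y =
      piWeight lam mu v y * ENNReal.ofReal (-queueGen lam mu T y y) := by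
  obtain ⟨n, z⟩ := y
  have hρ := h.rho_pos
  have hv := h.inv.nonneg
  have hTn := ((h.gen n).toIsRateMatrix.isConservative).diag_nonpos
  have hmu := h.mu_pos z
  have hlam := h.lam_pos z
  have henv : ∀ z', piWeight lam mu v (n, z') * jumpRate (queueEnv lam mu T n) z' z =
      ENNReal.ofReal (normConst lam mu v)⁻¹ *
        (ENNReal.ofReal (v z') * jumpRate (T n) z' z) := by
    intro z'
    have := pow_pos (hρ z') n
    rw [jumpRate_queueEnv fun z => (hρ z).le, piWeight, ← mul_assoc, ← mul_assoc,
      ← ENNReal.ofReal_mul (div_nonneg (mul_nonneg this.le (hv z')) hΞ.le),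
      ← ENNReal.ofReal_mul (inv_nonneg.2 hΞ.le)]
    congr 2
    field_simp
  rw [queueGen_eq_levelGen, tsum_mul_jumpRate_levelGen, levelGen_diag]
  simp_rw [henv]
  rw [ENNReal.tsum_mul_left,
    h.inv.tsum_mul_jumpRate (fun n => (h.gen n).toIsRateMatrix), neg_add, neg_neg]
  have hpow := pow_pos (hρ z) n
  have hvz := hv z
  have hn : 0 ≤ if n = 0 then 0 else mu z := by split_ifs; exacts [le_rfl, hmu.le]
  have henv0 : 0 ≤ -queueEnv lam mu T n z z := by
    unfold queueEnv
    rw [← mul_neg]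
    exact mul_nonneg (inv_nonneg.2 hpow.le) (neg_nonneg.2 (hTn z))
  rw [ENNReal.ofReal_add (add_nonneg hlam.le hn) henv0, ENNReal.ofReal_add hlam.le hn, mul_add,
    mul_add, add_assoc, add_left_comm]
  refine congrArg₂ (· + ·) ?_ (congrArg₂ (· + ·) ?_ ?_)
  · rw [piWeight, piWeight, ← ENNReal.ofReal_mul (by positivity),
      ← ENNReal.ofReal_mul (by positivity)]
    congr 1
    simp only [pow_succ]
    field_simp
  · rcases n with _ | n
    · simp
    · simp only [Nat.succ_ne_zero, if_false, Nat.add_sub_cancel, piWeight]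
      rw [← ENNReal.ofReal_mul (by positivity), ← ENNReal.ofReal_mul (by positivity)]
      congr 1
      rw [pow_succ]
      field_simp
  · rw [piWeight, ← ENNReal.ofReal_mul hvz, ← ENNReal.ofReal_mul (inv_nonneg.2 hΞ.le),
      ← ENNReal.ofReal_mul (by positivity), queueEnv]
    congr 1
    simp only
    field_simp

variable [Countable D]

/-- The measure `π` is stationary: it is subinvariant, and the queue does not lose mass. -/
theorem QueueAssumptions.tsum_piWeight_mul_semi (h : QueueAssumptions T v lam mu l m)
    (hΞ : Summable fun z => v z / (1 - lam z / mu z)) {t : ℝ} (ht : 0 ≤ t) {f : ℕ × D → ℝ≥0∞}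
    (hf : ∀ y, f y ≤ 1) :
    ∑' x, piWeight lam mu v x * semi (queueGen lam mu T) t f x =
      ∑' y, piWeight lam mu v y * f y := by
  have hle : ∀ f : ℕ × D → ℝ≥0∞, ∑' x, piWeight lam mu v x * semi (queueGen lam mu T) t f x ≤
      ∑' y, piWeight lam mu v y * f y := by
    intro f
    simp only [semi, ← ENNReal.tsum_mul_left, transKer_of_nonneg _ _ _ ht]
    rw [ENNReal.tsum_comm]
    refine ENNReal.tsum_le_tsum fun y => ?_
    simp_rw [← mul_assoc]
    rw [ENNReal.tsum_mul_right]
    exact mul_le_mul' (tsum_mul_trans_le h.isConservative.diag_nonpos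
      (h.balance (h.normConst_pos hΞ)) ht y) le_rfl
  have hff : (fun y => f y + (1 - f y)) = fun _ => (1 : ℝ≥0∞) :=
    funext fun y => add_tsub_cancel_of_le (hf y)
  have e1 : ∑' x, piWeight lam mu v x * semi (queueGen lam mu T) t f x +
      ∑' x, piWeight lam mu v x * semi (queueGen lam mu T) t (fun y => 1 - f y) x = 1 := by
    rw [← ENNReal.tsum_add]
    refine (tsum_congr fun x => ?_).trans (h.tsum_piWeight hΞ)
    rw [← mul_add, ← semi_add, hff, h.semi_queue_one ht, mul_one]
  have e2 : ∑' y, piWeight lam mu v y * f y + ∑' y, piWeight lam mu v y * (1 - f y) = 1 := by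
    rw [← ENNReal.tsum_add]
    refine (tsum_congr fun x => ?_).trans (h.tsum_piWeight hΞ)
    rw [← mul_add, add_tsub_cancel_of_le (hf x), mul_one]
  have hfin : ∑' y, piWeight lam mu v y * (1 - f y) ≠ ∞ :=
    ne_top_of_le_ne_top ENNReal.one_ne_top (le_add_self.trans_eq e2)
  refine le_antisymm (hle f) ((ENNReal.add_le_add_iff_right hfin).1 ?_)
  exact (e2.trans e1.symm).trans_le (add_le_add le_rfl (hle _))

end Stationary

/-! ### Convergence in total variation -/

section Convergence

variable {D : Type u} {T : ℕ → D → D → ℝ} {v lam mu : D → ℝ} {l m : ℝ}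

theorem transMeasure_apply {S : Type*} [MeasurableSpace S] (Q : S → S → ℝ) {t : ℝ} (ht : 0 ≤ t)
    (x : S) {A : Set S} (hA : MeasurableSet A) :
    transMeasure Q t x A = semi Q t (A.indicator 1) x := by
  simp [transMeasure, Measure.sum_apply _ hA, semi, transKer_of_nonneg _ _ _ ht,
    Measure.dirac_apply' _ hA]

theorem stationary_apply [MeasurableSpace D] {A : Set (ℕ × D)} (hA : MeasurableSet A) :
    stationary lam mu v A = ∑' x, piWeight lam mu v x * A.indicator 1 x := by
  simp [stationary, Measure.sum_apply _ hA, piWeight, Measure.dirac_apply' _ hA]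

theorem abs_toReal_sub_le {p q : ℝ≥0∞} {e : ℝ} (he : 0 ≤ e) (hp : p ≠ ∞) (hq : q ≠ ∞)
    (hpq : p ≤ q + ENNReal.ofReal e) (hqp : q ≤ p + ENNReal.ofReal e) :
    |p.toReal - q.toReal| ≤ e := by
  have h : ∀ {p q : ℝ≥0∞}, q ≠ ∞ → p ≤ q + ENNReal.ofReal e → p.toReal ≤ q.toReal + e := by
    intro p q hq hpq
    have := ENNReal.toReal_mono (ENNReal.add_ne_top.2 ⟨hq, ENNReal.ofReal_ne_top⟩) hpq
    rwa [ENNReal.toReal_add hq ENNReal.ofReal_ne_top, ENNReal.toReal_ofReal he] at this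
  rw [abs_le]
  constructor <;> linarith [h hq hpq, h hp hqp]

variable [Countable D] [MeasurableSpace D] [DiscreteMeasurableSpace D]

theorem QueueAssumptions.tvDist_le (h : QueueAssumptions T v lam mu l m)
    (hΞ : Summable fun z => v z / (1 - lam z / mu z)) {α γ : ℝ} (hα : 1 < α) (hγ : 0 < γ)
    (hcoup : HasExpCoupling.{u, w} (T 0) α γ) {ε c : ℝ} (hadm : Admissible l m α γ ε c) :
    ∃ C : ℝ, 0 < C ∧ ∀ (n₀ : ℕ) (z₀ : D) (t : ℝ), 0 ≤ t →
      tvDist (transMeasure (queueGen lam mu T) t (n₀, z₀)) (stationary lam mu v) ≤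
        C * (1 + c ^ n₀) * Real.exp (-((1 - ε) * mFun l m c * t)) := by
  obtain ⟨hε0, hε1⟩ := hadm.eps_mem
  have hc1 : 1 < c := hadm.c_mem.1
  have hl := h.l_pos
  have hm := h.m_pos
  have hM0 := mFun_nonneg hl h.l_lt_m hadm.c_mem
  obtain ⟨κ, hκ0, hκ1, hκ⟩ := hadm.exists_contraction hα hl hγ
  set a := (1 - ε) * mFun l m c with ha
  set b := c ^ (1 - ε) with hb
  -- the choice of `K` absorbs the contribution of no interruption up to time `t` at level zero
  set K := α / (1 - κ) with hK
  have hb1 : 1 ≤ b := Real.one_le_rpow hc1.le (by linarith)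
  have hbc : b ≤ c := by
    simpa using Real.rpow_le_rpow_of_exponent_le hc1.le (by linarith : 1 - ε ≤ 1)
  have hK0 : 0 < K := div_pos (by linarith) (by linarith)
  have hKα : α ≤ K * (1 - κ) := (div_mul_cancel₀ α (by linarith : 1 - κ ≠ 0)).ge
  have hdrift : l * b + m * b⁻¹ ≤ l + m - a := by
    have := mFun_rpow_ge (l := l) (m := m) hl hm (by linarith : 0 < c)
      (by linarith : 0 ≤ 1 - ε) (by linarith)
    rw [← ha, ← hb] at this
    unfold mFun at this
    linarith
  have haγ : a ≤ l + γ := by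
    have := hadm.m_lt
    have : a ≤ mFun l m c := mul_le_of_le_one_left hM0 (by linarith)
    linarith
  have hosc := fun {t : ℝ} (ht : 0 ≤ t) {f : ℕ × D → ℝ≥0∞} (hf : ∀ y, f y ≤ 1) (x y : ℕ × D) =>
    h.osc_le hb1 hdrift hα hcoup haγ hκ0 hκ1 hκ hKα ht hf (le_max_left x.1 y.1)
      (le_max_right x.1 y.1)
  have hΞ0 := h.normConst_pos hΞ
  -- the moment of order `c` of the level under `π`
  have hcfin : ∑' x : ℕ × D, piWeight lam mu v x * ENNReal.ofReal (c ^ x.1) ≠ ∞ := by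
    refine h.tsum_piWeight_mul_pow_ne_top hΞ0 (by linarith) ?_
    have := sq_lt_of_lt_cStar hl hm (by linarith) hadm.c_mem.2
    rw [lt_div_iff₀ hl] at this
    rw [div_mul_eq_mul_div, div_lt_one hm]
    nlinarith
  set M := (∑' x : ℕ × D, piWeight lam mu v x * ENNReal.ofReal (c ^ x.1)).toReal with hM
  have hMnn : 0 ≤ M := ENNReal.toReal_nonneg
  refine ⟨K * (1 + M), by positivity, fun n₀ z₀ t ht => ?_⟩
  refine ciSup_le fun ⟨A, hA⟩ => ?_
  have hcn : 0 ≤ c ^ n₀ := pow_nonneg (by linarith) _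
  set f : ℕ × D → ℝ≥0∞ := A.indicator 1 with hf
  have hf1 : ∀ y, f y ≤ 1 := fun y => indicator_le_self' (fun _ _ => zero_le) y
  set U := semi (queueGen lam mu T) t f with hU
  have hpi : stationary lam mu v A = ∑' x, piWeight lam mu v x * U x := by
    rw [stationary_apply hA, h.tsum_piWeight_mul_semi hΞ ht hf1]
  set B : ℕ × D → ℝ := fun x => K * Real.exp (-a * t) * (c ^ n₀ + c ^ x.1) with hB
  have hBle : ∀ i j : ℕ, K * b ^ max i j * Real.exp (-a * t) ≤
      K * Real.exp (-a * t) * (c ^ i + c ^ j) := by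
    intro i j
    have h1 : b ^ max i j ≤ c ^ i + c ^ j := by
      have hi : 0 ≤ c ^ i := pow_nonneg (by linarith) _
      have hj : 0 ≤ c ^ j := pow_nonneg (by linarith) _
      refine (pow_le_pow_left₀ (by linarith) hbc _).trans ?_
      rcases max_choice i j with h' | h' <;> rw [h'] <;> linarith
    calc _ = K * Real.exp (-a * t) * b ^ max i j := by ring
      _ ≤ _ := mul_le_mul_of_nonneg_left h1 (by positivity)
  have h1 : ∀ x, U (n₀, z₀) ≤ U x + ENNReal.ofReal (B x) := fun x =>
    (hosc ht hf1 (n₀, z₀) x).trans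
      (add_le_add le_rfl (ENNReal.ofReal_le_ofReal (hBle n₀ x.1)))
  have h2 : ∀ x, U x ≤ U (n₀, z₀) + ENNReal.ofReal (B x) := fun x =>
    (hosc ht hf1 x (n₀, z₀)).trans (add_le_add le_rfl (ENNReal.ofReal_le_ofReal
      ((hBle x.1 n₀).trans_eq (by rw [hB]; ring))))
  have hsum : ∑' x, piWeight lam mu v x * ENNReal.ofReal (B x) =
      ENNReal.ofReal (K * Real.exp (-a * t) * (c ^ n₀ + M)) := by
    have : ∀ x : ℕ × D, piWeight lam mu v x * ENNReal.ofReal (B x) =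
        ENNReal.ofReal (K * Real.exp (-a * t)) * (piWeight lam mu v x * ENNReal.ofReal (c ^ n₀) +
          piWeight lam mu v x * ENNReal.ofReal (c ^ x.1)) := by
      intro x
      rw [hB, ENNReal.ofReal_mul (by positivity),
        ENNReal.ofReal_add hcn (pow_nonneg (by linarith) _)]
      ring
    simp_rw [this]
    rw [ENNReal.tsum_mul_left, ENNReal.tsum_add, ENNReal.tsum_mul_right, h.tsum_piWeight hΞ,
      one_mul, ← ENNReal.ofReal_toReal hcfin, ← hM, ← ENNReal.ofReal_add hcn hMnn,
      ← ENNReal.ofReal_mul (by positivity)]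
  have hconst : ∑' x, piWeight lam mu v x * U (n₀, z₀) = U (n₀, z₀) := by
    rw [ENNReal.tsum_mul_right, h.tsum_piWeight hΞ, one_mul]
  have hU1 : ∀ x, U x ≤ 1 := fun x =>
    (semi_mono _ _ hf1 x).trans_eq (h.semi_queue_one ht x)
  have hpi_fin : ∑' x, piWeight lam mu v x * U x ≠ ∞ :=
    ne_top_of_le_ne_top ENNReal.one_ne_top ((ENNReal.tsum_le_tsum fun x =>
      (mul_le_mul' le_rfl (hU1 x)).trans_eq (mul_one _)).trans_eq (h.tsum_piWeight hΞ))
  have habs := abs_toReal_sub_le (e := K * Real.exp (-a * t) * (c ^ n₀ + M)) (by positivity)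
    (ne_top_of_le_ne_top ENNReal.one_ne_top (hU1 (n₀, z₀))) hpi_fin
    (by
      rw [← hsum, ← ENNReal.tsum_add]
      conv_lhs => rw [← hconst]
      refine ENNReal.tsum_le_tsum fun x => ?_
      rw [← mul_add]
      exact mul_le_mul' le_rfl (h1 x))
    (by
      rw [← hsum]
      conv_rhs => rw [← hconst]
      rw [← ENNReal.tsum_add]
      refine ENNReal.tsum_le_tsum fun x => ?_
      rw [← mul_add]
      exact mul_le_mul' le_rfl (h2 x))
  rw [Measure.real, Measure.real, transMeasure_apply _ ht _ hA, hpi]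
  refine habs.trans ?_
  have hexp : Real.exp (-(a * t)) = Real.exp (-a * t) := by rw [neg_mul]
  rw [hexp]
  calc K * Real.exp (-a * t) * (c ^ n₀ + M)
      ≤ K * Real.exp (-a * t) * ((1 + M) * (1 + c ^ n₀)) :=
        mul_le_mul_of_nonneg_left (by nlinarith) (by positivity)
    _ = _ := by ring

end Convergence

end InteractiveQueue

theorem mainTheorem5 {D : Type u} [Countable D] [MeasurableSpace D]
    [DiscreteMeasurableSpace D]
    -- nominal environment generators, with a common invariant measure `v`
    (T : ℕ → D → D → ℝ)
    (hT : ∀ n, InteractiveQueue.IsChainGenerator (T n))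
    (hTirr : ∀ n, InteractiveQueue.IsIrreducible (T n))
    (v : D → ℝ) (hv : InteractiveQueue.IsCommonInvariant T v)
    -- arrival and service rates, bounded by `lamBar < muBar`
    (lam mu : D → ℝ) (hlam : ∀ z, 0 < lam z)
    (lamBar muBar : ℝ) (hlamBar : 0 < lamBar) (hbar : lamBar < muBar)
    (hlam_le : ∀ z, lam z ≤ lamBar) (hmu_ge : ∀ z, muBar ≤ mu z)
    -- finiteness of the normalization constant of `π`
    (hΞ : Summable fun z => v z / (1 - lam z / mu z))
    -- coupling of the environment at queue level `0`
    (α γ : ℝ) (hα : 1 < α) (hγ : 0 < γ)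
    (hcoup : InteractiveQueue.HasExpCoupling.{u, w} (T 0) α γ) :
    (∀ ε ∈ Set.Ioo (0 : ℝ) 1, ∃ c, InteractiveQueue.Admissible lamBar muBar α γ ε c) ∧
    ∀ ε c : ℝ, InteractiveQueue.Admissible lamBar muBar α γ ε c →
      ∃ C : ℝ, 0 < C ∧ ∀ (n₀ : ℕ) (z₀ : D) (t : ℝ), 0 ≤ t →
        InteractiveQueue.tvDist
            (InteractiveQueue.transMeasure (InteractiveQueue.queueGen lam mu T) t (n₀, z₀))
            (InteractiveQueue.stationary lam mu v) ≤
          C * (1 + c ^ n₀) *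
            Real.exp (-((1 - ε) * InteractiveQueue.mFun lamBar muBar c * t)) := by
  have hm : 0 < muBar := hlamBar.trans hbar
  have hρ : ∀ z, lam z / mu z < 1 := fun z =>
    (div_lt_one (hm.trans_le (hmu_ge z))).2
      ((hlam_le z).trans_lt (hbar.trans_le (hmu_ge z)))
  have hvs : Summable v := by
    refine hΞ.of_nonneg_of_le hv.nonneg fun z => le_div_self (hv.nonneg z) (sub_pos.2 (hρ z)) ?_
    exact sub_le_self _ (div_nonneg (hlam z).le (hm.le.trans (hmu_ge z)))
  have h : InteractiveQueue.QueueAssumptions T v lam mu lamBar muBar :=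
    ⟨hT, hTirr 0, hv, hvs, hlam, hlamBar, hbar, hlam_le, hmu_ge⟩
  exact ⟨fun ε hε => InteractiveQueue.exists_admissible hα hlamBar hbar hγ hε,
    fun ε c hadm => h.tvDist_le hΞ hα hγ hcoup hadm⟩
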